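/- Let $X$ be a connected CW-complex with base point $x$ and $G=\pi_1(X,x)$, let $\phi: G\to\mathbb Z^r$ be a surjective homomorphism, $K=\operatorname{Ker}\phi$, $K'=[K,K]$, and let $A(G,\phi)\otimes\mathbb C=(K/K')\otimes_{\mathbb Z}\mathbb C$ be the Alexander invariant, a module over $R=\mathbb C[\mathbb Z^r]$ on which $\mathbb Z^r=G/K$ acts by conjugation. Assume that it is a finitely generated $R$-module (as is the case when $G$ is finitely generated). For $k\ge 0$ let $V_k(G,\phi)\subseteq(\mathbb C^*)^r=\operatorname{Spec}R$ be the zero set of the $k$-th Fitting ideal of this module, i.e. of the ideal generated by the $(n-k+1)\times(n-k+1)$ minors of the matrix of $\Phi$ in a presentation $R^m\xrightarrow{\Phi}R^n\to A(G,\phi)\otimes\mathbb C\to 0$ (minors of size $\le 0$ are $1$, so that $V_k(G,\phi)=\emptyset$ for $k>n$; and $V_0(G,\phi)=(\mathbb C^*)^r$). For $P\in(\mathbb C^*)^r$ put $$f(P,(G,\phi))=\max\{k \mid P\in V_k(G,\phi)\}.$$ Let $n_1,\dots,n_r\ge 1$ and let $X_{n_1,\dots,n_r}\to X$ be the finite unbranched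 abelian cover corresponding to the kernel of $G\xrightarrow{\phi}\mathbb Z^r\to\bigoplus_{i=1}^r\mathbb Z/n_i\mathbb Z$ (a quotient of the infinite abelian cover of $X$ corresponding to $\operatorname{Ker}\phi$). Then $H_1(X,\mathbb C)$ and $H_1(X_{n_1,\dots,n_r},\mathbb C)$ are finite-dimensional, and $$\dim H_1(X_{n_1,\dots,n_r},\mathbb C)=\dim H_1(X,\mathbb C)+\sum_{\substack{\omega_i^{n_i}=1\ (1\le i\le r)\\ (\omega_1,\dots,\omega_r)\ne(1,\dots,1)}} f\bigl((\omega_1,\dots,\omega_r),(G,\phi)\bigr).$$ In particular, if $\dim H_1(X,\mathbb C)=r$ (i.e. $\phi$ is the projection of $G$ onto $H_1(X,\mathbb Z)$ modulo torsion, for example the abelianization of a link group), then $$\dim H_1(X_{n_1,\dots,n_r},\mathbb C)=r+\sum_{\substack{\omega_i^{n_i}=1\ (1\le i\le r)\\ (\omega_1,\dots,\omega_r)\ne(1,\dots,1)}} f\bigl((\omega_1,\dots,\omega_r),(G,\phi)\bigr).$$ -/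

import Mathlib

noncomputable section

open scoped TensorProduct

/-! ### Fitting ideals and characteristic varieties of modules -/

/-- The `k`-th Fitting ideal of an `R`-module `M`, generated by the
`(n - k + 1) × (n - k + 1)` minors of a presentation matrix `A` of `M`
(`R^m → R^n → M → 0`). The ideal does not depend on the presentation; here it is
generated by the minors of all finite presentations. For `k > n` the minor is the empty
determinant `1`, and the ideal is the unit ideal. -/
def fittingIdeal (R : Type*) [CommRing R] (M : Type*) [AddCommGroup M] [Module R M]
    (k : ℕ) : Ideal R :=
  Ideal.span {d : R | ∃ (m n : ℕ) (A : Matrix (Fin n) (Fin m) R)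
    (π : (Fin n → R) →ₗ[R] M),
    Function.Surjective π ∧ LinearMap.range A.mulVecLin = LinearMap.ker π ∧
    ∃ (a : Fin (n + 1 - k) → Fin n) (b : Fin (n + 1 - k) → Fin m),
      d = (A.submatrix a b).det}

/-- The free abelian group `ℤ^r`, written multiplicatively. -/
abbrev FreeAb (r : ℕ) : Type := Multiplicative (Fin r → ℤ)

/-- The group ring `ℂ[ℤ^r]`, that is, the ring of Laurent polynomials in `r` variables. -/
abbrev LaurentRing (r : ℕ) : Type := MonoidAlgebra ℂ (FreeAb r)

/-- The character `t ↦ P₁^{t₁} ⋯ P_r^{t_r}` of `ℤ^r` given by a point `P` of `(ℂ^*)^r`. -/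
def torusChar {r : ℕ} (P : Fin r → ℂˣ) : FreeAb r →* ℂ where
  toFun t := ((∏ i, P i ^ (t.toAdd i) : ℂˣ) : ℂ)
  map_one' := by simp
  map_mul' s t := by simp [zpow_add, Finset.prod_mul_distrib]

/-- Evaluation of Laurent polynomials at a point of the torus `(ℂ^*)^r`. -/
def evalTorus {r : ℕ} (P : Fin r → ℂˣ) : LaurentRing r →ₐ[ℂ] ℂ :=
  MonoidAlgebra.lift ℂ ℂ (FreeAb r) (torusChar P)

/-- The `k`-th characteristic variety of a `ℂ[ℤ^r]`-module, as a subset of `(ℂ^*)^r`. -/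
def moduleCharVariety {r : ℕ} (M : Type*) [AddCommGroup M] [Module (LaurentRing r) M]
    (k : ℕ) : Set (Fin r → ℂˣ) :=
  {P | ∀ F ∈ fittingIdeal (LaurentRing r) M k, evalTorus P F = 0}

/-! ### The Alexander invariant of a pair `(G, φ)` -/

section Alexander

variable {G : Type*} [Group G] {r : ℕ} (φ : G →* FreeAb r)

/-- The space `K/K' ⊗ ℂ`, where `K = Ker φ` and `K' = [K, K]`. -/
abbrev AlexanderSpace : Type _ := ℂ ⊗[ℤ] Additive (Abelianization φ.ker)

/-- The action of `G` on `K/K' ⊗ ℂ` induced by conjugation `k ↦ g k g⁻¹`. -/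
def conjRep : Representation ℂ G (AlexanderSpace φ) where
  toFun g := LinearMap.baseChange ℂ
    (MonoidHom.toAdditive
      (Abelianization.map (MulAut.conjNormal (H := φ.ker) g).toMonoidHom)).toIntLinearMap
  map_one' := by
    ext x
    induction x using Additive.rec with
    | ofMul x =>
      induction x using QuotientGroup.induction_on with
      | H x =>
        change (1 : ℂ) ⊗ₜ[ℤ] Additive.ofMul (Abelianization.of _) = _
        simp
        rfl
  map_mul' g h := by
    ext x
    induction x using Additive.rec with
    | ofMul x =>
      induction x using QuotientGroup.induction_on with
      | H x =>
        change (1 : ℂ) ⊗ₜ[ℤ] Additive.ofMul (Abelianization.of _) = _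
        simp
        rfl

theorem conjRep_ker (g : G) (hg : g ∈ φ.ker) : conjRep φ g = 1 := by
  ext x
  induction x using Additive.rec with
  | ofMul x =>
    induction x using QuotientGroup.induction_on with
    | H x =>
      change (1 : ℂ) ⊗ₜ[ℤ] Additive.ofMul (Abelianization.of _) =
        (1 : ℂ) ⊗ₜ[ℤ] Additive.ofMul (Abelianization.of x)
      have h : (MulAut.conjNormal (H := φ.ker) g).toMonoidHom x
          = (⟨g, hg⟩ : φ.ker) * x * (⟨g, hg⟩ : φ.ker)⁻¹ := by
        ext; simp
      rw [h]
      simp [mul_comm]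

/-- The action of `ℤ^r = G/K` on `K/K' ⊗ ℂ` for surjective `φ`: an element `t` acts as
conjugation by any `g` with `φ g = t`. -/
def alexanderRep (hφ : Function.Surjective φ) :
    Representation ℂ (FreeAb r) (AlexanderSpace φ) :=
  (QuotientGroup.lift φ.ker (conjRep φ) (fun g hg => conjRep_ker φ g hg)).comp
    (QuotientGroup.quotientKerEquivOfSurjective φ hφ).symm.toMonoidHom

/-- The Alexander invariant `A(G, φ) ⊗ ℂ` as a module over `ℂ[ℤ^r]`. -/
abbrev AlexanderModule (hφ : Function.Surjective φ) : Type _ := (alexanderRep φ hφ).asModule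

/-- The characteristic variety `V_k(G, φ) ⊆ (ℂ^*)^r`. -/
def charVariety (hφ : Function.Surjective φ) (k : ℕ) : Set (Fin r → ℂˣ) :=
  moduleCharVariety (AlexanderModule φ hφ) k

/-- The depth `f(P, (G, φ)) = max {k | P ∈ V_k(G, φ)}`. As `V_0(G, φ)` is the whole torus,
the depth of a point outside `V_1(G, φ)` is `0`. -/
def depth (hφ : Function.Surjective φ) (P : Fin r → ℂˣ) : ℕ :=
  sSup {k : ℕ | P ∈ charVariety φ hφ k}

end Alexander

/-! ### Covering spaces and first homology -/

/-- The projection `ℤ^r → ⊕ ℤ/n_i`. -/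
def reductionMod {r : ℕ} (n : Fin r → ℕ) : FreeAb r →* Multiplicative (∀ i, ZMod (n i)) :=
  AddMonoidHom.toMultiplicative
    (AddMonoidHom.pi fun i => (Int.castAddHom (ZMod (n i))).comp (Pi.evalAddMonoidHom _ i))

/-- `p : (E, e) → (X, x)` is the (path-connected) covering of `X` corresponding to the subgroup
`N` of `π₁(X, x)`: it is a covering map and `p_* π₁(E, e) = N`. -/
structure IsCoveringOf {X : Type*} [TopologicalSpace X] {E : Type*} [TopologicalSpace E]
    (p : C(E, X)) (e : E) {x : X} (hx : p e = x) (N : Subgroup (FundamentalGroup X x)) :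
    Prop where
  pathConnected : PathConnectedSpace E
  isCoveringMap : IsCoveringMap p
  range_eq : (FundamentalGroup.mapOfEq p hx).range = N

/-- The first singular homology `H_1(Y, ℂ)`. -/
abbrev H1.{u} (Y : Type u) [TopologicalSpace Y] : ModuleCat.{u} ℂ :=
  ((AlgebraicTopology.singularHomologyFunctor (ModuleCat.{u} ℂ) 1).obj
    (ModuleCat.of ℂ (ULift.{u} ℂ))).obj (TopCat.of Y)

end

/-!
By the Hurewicz theorem, `H₁(Y, ℂ)` is dual to `Hom(π₁(Y), ℂ)`, so the two sides concern
`Hom(N, ℂ)` and `Hom(G, ℂ)`, where `N = π₁(X_{n₁,…,n_r})` is the kernel of the reduction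
`G → B = ⊕ ℤ/n_i`. Conjugation makes `Hom(N, ℂ)` a representation of the finite abelian group `B`,
hence a direct sum of weight spaces `Hom_χ(N, ℂ)` over the characters `χ` of `B`, i.e. over the
points `ω` of the torus with `ω_i ^ n_i = 1`. The weight space of `χ = 1` is `Hom(G, ℂ)`, by
transfer. For `χ ≠ 1`, restriction to `K = ker φ` is an isomorphism `Hom_χ(N, ℂ) → Hom_χ(K, ℂ)`: if
`χ g ≠ 1`, a form `u` on `K` extends to `N` only by `x ↦ u ⁅g, x⁆ / (χ g - 1)`. Finally
`Hom_χ(K, ℂ)` is the dual of the fibre at `ω` of the Alexander module, and the dimension of the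
fibre of a finitely presented module at a point is the largest `k` such that the point lies in the
zero set of the `k`-th Fitting ideal.
-/

noncomputable section

/-! ### The Hurewicz theorem in degree one -/

section Homology

open CategoryTheory Limits Simplicial

universe u

section DualHomology

variable {k C₂ C₁ C₀ : Type*} [Field k] [AddCommGroup C₂] [Module k C₂] [AddCommGroup C₁]
  [Module k C₁] [AddCommGroup C₀] [Module k C₀]
  (d₂ : C₂ →ₗ[k] C₁) (d₁ : C₁ →ₗ[k] C₀) (hd : ∀ x, d₂ x ∈ LinearMap.ker d₁)

/-- The functional on the homology of `C₂ → C₁ → C₀` induced by a functional on `C₁` that vanishes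
on the image of `C₂`. -/
def dualHomologyMap : LinearMap.ker d₂.dualMap →ₗ[k]
    Module.Dual k (LinearMap.ker d₁ ⧸ LinearMap.range (d₂.codRestrict (LinearMap.ker d₁) hd)) :=
  (Submodule.dualQuotEquivDualAnnihilator _).symm.toLinearMap ∘ₗ
    LinearMap.codRestrict _ ((LinearMap.ker d₁).dualRestrict ∘ₗ Submodule.subtype _)
      fun Φ => (Submodule.mem_dualAnnihilator _).2 <| by
        rintro _ ⟨x, rfl⟩
        exact LinearMap.congr_fun (LinearMap.mem_ker.1 Φ.2) x

theorem dualHomologyMap_surjective : Function.Surjective (dualHomologyMap d₂ d₁ hd) := by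
  refine (Submodule.dualQuotEquivDualAnnihilator _).symm.surjective.comp ?_
  rintro ⟨ψ, hψ⟩
  obtain ⟨Φ, rfl⟩ := Subspace.dualRestrict_surjective ψ
  rw [Submodule.mem_dualAnnihilator] at hψ
  exact ⟨⟨Φ, LinearMap.ext fun x => hψ _ ⟨x, rfl⟩⟩, rfl⟩

variable {d₂} in
theorem mem_ker_dualHomologyMap (Φ : LinearMap.ker d₂.dualMap) :
    Φ ∈ LinearMap.ker (dualHomologyMap d₂ d₁ hd) ↔ Φ.1 ∈ LinearMap.range d₁.dualMap := by
  rw [LinearMap.range_dualMap_eq_dualAnnihilator_ker,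
    ← Submodule.dualRestrict_ker_eq_dualAnnihilator, LinearMap.mem_ker, LinearMap.mem_ker,
    dualHomologyMap, LinearMap.comp_apply, LinearEquiv.coe_coe, LinearEquiv.map_eq_zero_iff,
    Subtype.ext_iff]
  rfl

end DualHomology

section Cochains

/-- The coefficients `k` of the singular chain complex, in the universe of the simplices. -/
abbrev chainCoeff (k : Type) [CommRing k] : ModuleCat.{u} k := ModuleCat.of k (ULift.{u} k)

variable (k : Type) [CommRing k] (S : SSet.{u})

/-- The coboundary of simplicial cochains with coefficients in `k`. -/
def simplicialCoboundary (n : ℕ) : (S _⦋n⦌ → k) →ₗ[k] (S _⦋n + 1⦌ → k) :=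
  ∑ i : Fin (n + 2), (-1 : k) ^ (i : ℕ) • LinearMap.funLeft k k (S.δ i)

variable {k S} in
theorem simplicialCoboundary_apply {n : ℕ} (c : S _⦋n⦌ → k) (σ : S _⦋n + 1⦌) :
    simplicialCoboundary k S n c σ = ∑ i : Fin (n + 2), (-1) ^ (i : ℕ) * c (S.δ i σ) := by
  simp [simplicialCoboundary, LinearMap.funLeft]

variable {S} in
/-- The generator of the module of `n`-chains given by an `n`-simplex. -/
def simplexChain {n : ℕ} (σ : S _⦋n⦌) : (S.chainComplex (chainCoeff.{u} k)).X n :=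
  (S.ιChainComplex (R := chainCoeff k) σ).hom ⟨1⟩

theorem d_simplexChain {n : ℕ} (σ : S _⦋n + 1⦌) :
    ((S.chainComplex (chainCoeff.{u} k)).d (n + 1) n).hom (simplexChain k σ) =
      ∑ i : Fin (n + 2), (-1 : k) ^ (i : ℕ) • simplexChain k (S.δ i σ) := by
  refine (congrArg (fun f => f.hom ⟨1⟩)
    (S.ιChainComplex_d (R := chainCoeff k) σ)).trans ?_
  simp only [ModuleCat.hom_sum, ModuleCat.hom_zsmul, LinearMap.sum_apply, LinearMap.smul_apply]
  refine Finset.sum_congr rfl fun i _ => ?_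
  rw [← Int.cast_smul_eq_zsmul k]
  push_cast
  rfl

variable {k S} in
theorem chainDual_ext {n : ℕ} {Φ Ψ : Module.Dual k ((S.chainComplex (chainCoeff.{u} k)).X n)}
    (h : ∀ σ : S _⦋n⦌, Φ (simplexChain k σ) = Ψ (simplexChain k σ)) : Φ = Ψ := by
  let up : k →ₗ[k] ULift.{u} k := ULift.moduleEquiv.symm.toLinearMap
  have hup : ModuleCat.ofHom (up ∘ₗ Φ) = ModuleCat.ofHom (up ∘ₗ Ψ) := by
    refine SSet.chainComplex_hom_ext fun σ => ModuleCat.hom_ext (LinearMap.ext fun a => ?_)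
    have ha : a = a.down • (⟨1⟩ : ULift.{u} k) := by ext; simp
    rw [ha, map_smul, map_smul]
    exact congrArg (fun z => a.down • up z) (h σ)
  exact LinearMap.ext fun v =>
    congrArg ULift.down (LinearMap.congr_fun (congrArg ModuleCat.Hom.hom hup) v)

theorem exists_chainDual_eq {n : ℕ} (c : S _⦋n⦌ → k) :
    ∃ Φ : Module.Dual k ((S.chainComplex (chainCoeff.{u} k)).X n),
      ∀ σ, Φ (simplexChain k σ) = c σ := by
  let s : Cofan fun _ : S _⦋n⦌ => chainCoeff k := Cofan.mk _ fun σ => c σ • 𝟙 (chainCoeff.{u} k)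
  let hcolim := S.isColimitChainComplexXCofan (chainCoeff.{u} k) n
  refine ⟨ULift.moduleEquiv.toLinearMap ∘ₗ (hcolim.desc s).hom, fun σ => ?_⟩
  refine (congrArg (fun f => ULift.down (f.hom ⟨1⟩)) (hcolim.fac s ⟨σ⟩)).trans ?_
  exact mul_one (c σ)

/-- Functionals on the module of `n`-chains are `n`-cochains. -/
def chainDualEquiv (n : ℕ) :
    Module.Dual k ((S.chainComplex (chainCoeff.{u} k)).X n) ≃ₗ[k] (S _⦋n⦌ → k) :=
  LinearEquiv.ofBijective (LinearMap.pi fun σ => Module.Dual.eval k _ (simplexChain k σ))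
    ⟨fun _ _ h => chainDual_ext (congrFun h), fun c =>
      (exists_chainDual_eq k S c).imp fun _ h => funext h⟩

variable {k S} in
@[simp]
theorem chainDualEquiv_apply {n : ℕ} (Φ : Module.Dual k ((S.chainComplex (chainCoeff.{u} k)).X n))
    (σ : S _⦋n⦌) : chainDualEquiv k S n Φ σ = Φ (simplexChain k σ) := rfl

variable {k S} in
theorem chainDualEquiv_dualMap_d {n : ℕ}
    (Φ : Module.Dual k ((S.chainComplex (chainCoeff.{u} k)).X n)) :
    chainDualEquiv k S (n + 1) (((S.chainComplex (chainCoeff.{u} k)).d (n + 1) n).hom.dualMap Φ) =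
      simplicialCoboundary k S n (chainDualEquiv k S n Φ) := by
  ext σ
  rw [chainDualEquiv_apply, LinearMap.dualMap_apply, d_simplexChain, simplicialCoboundary_apply]
  simp

variable {k S} in
theorem mem_ker_dualMap_d_iff {n : ℕ}
    (Φ : Module.Dual k ((S.chainComplex (chainCoeff.{u} k)).X n)) :
    Φ ∈ LinearMap.ker ((S.chainComplex (chainCoeff.{u} k)).d (n + 1) n).hom.dualMap ↔
      chainDualEquiv k S n Φ ∈ LinearMap.ker (simplicialCoboundary k S n) := by
  rw [LinearMap.mem_ker, LinearMap.mem_ker, ← chainDualEquiv_dualMap_d,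
    LinearEquiv.map_eq_zero_iff]

variable {k S} in
theorem mem_range_dualMap_d_iff {n : ℕ}
    (Φ : Module.Dual k ((S.chainComplex (chainCoeff.{u} k)).X (n + 1))) :
    Φ ∈ LinearMap.range ((S.chainComplex (chainCoeff.{u} k)).d (n + 1) n).hom.dualMap ↔
      chainDualEquiv k S (n + 1) Φ ∈ LinearMap.range (simplicialCoboundary k S n) := by
  rw [LinearMap.mem_range, LinearMap.mem_range, (chainDualEquiv k S n).surjective.exists]
  simp only [← chainDualEquiv_dualMap_d, EmbeddingLike.apply_eq_iff_eq]

end Cochains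

section CohomologyDual

theorem d_mem_ker_d {R : Type*} [Ring R] (C : ChainComplex (ModuleCat R) ℕ) (n : ℕ)
    (x : C.X (n + 2)) :
    (C.d (n + 2) (n + 1)).hom x ∈ LinearMap.ker (C.d (n + 1) n).hom :=
  (C.sc' (n + 2) (n + 1) n).moduleCat_zero_apply x

/-- Homology in positive degree as cycles modulo boundaries. -/
def homologySuccEquiv {R : Type*} [Ring R] (C : ChainComplex (ModuleCat R) ℕ) (n : ℕ) :
    C.homology (n + 1) ≃ₗ[R] (LinearMap.ker (C.d (n + 1) n).hom ⧸ LinearMap.range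
      ((C.d (n + 2) (n + 1)).hom.codRestrict (LinearMap.ker (C.d (n + 1) n).hom)
        (d_mem_ker_d C n))) :=
  (ShortComplex.homologyMapIso (C.isoSc' (n + 2) (n + 1) n (by simp) (by simp)) ≪≫
    (C.sc' (n + 2) (n + 1) n).moduleCatHomologyIso).toLinearEquiv

variable (k : Type) [Field k] (S : SSet.{u})

/-- Simplicial cocycles as the functionals on chains that vanish on boundaries. -/
def cocycleEquivChainDual (n : ℕ) : LinearMap.ker (simplicialCoboundary k S n) ≃ₗ[k]
    LinearMap.ker ((S.chainComplex (chainCoeff.{u} k)).d (n + 1) n).hom.dualMap :=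
  ((chainDualEquiv k S n).ofSubmodule' _).symm ≪≫ₗ LinearEquiv.ofEq _ _
    (Submodule.ext fun Φ => (mem_ker_dualMap_d_iff Φ).symm)

/-- The degree `n + 1` part of the universal coefficient map over a field: a cocycle acts on
homology classes. -/
def cocycleDualHomology (n : ℕ) : LinearMap.ker (simplicialCoboundary k S (n + 1)) →ₗ[k]
    Module.Dual k ((S.chainComplex (chainCoeff.{u} k)).homology (n + 1)) :=
  (homologySuccEquiv (S.chainComplex (chainCoeff.{u} k)) n).dualMap.toLinearMap ∘ₗ
    dualHomologyMap _ _ (d_mem_ker_d (S.chainComplex (chainCoeff.{u} k)) n) ∘ₗ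
    (cocycleEquivChainDual k S (n + 1)).toLinearMap

theorem cocycleDualHomology_surjective (n : ℕ) :
    Function.Surjective (cocycleDualHomology k S n) := by
  intro ψ
  obtain ⟨Φ, hΦ⟩ := dualHomologyMap_surjective _ _
    (d_mem_ker_d (S.chainComplex (chainCoeff.{u} k)) n)
    ((homologySuccEquiv (S.chainComplex (chainCoeff.{u} k)) n).symm.dualMap ψ)
  obtain ⟨c, rfl⟩ := (cocycleEquivChainDual k S (n + 1)).surjective Φ
  refine ⟨c, ?_⟩
  rw [cocycleDualHomology, LinearMap.comp_apply, LinearMap.comp_apply, LinearEquiv.coe_coe,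
    LinearEquiv.coe_coe, hΦ]
  exact LinearMap.ext fun x => congrArg ψ (LinearEquiv.symm_apply_apply _ x)

variable {k S} in
theorem mem_ker_cocycleDualHomology {n : ℕ}
    (c : LinearMap.ker (simplicialCoboundary k S (n + 1))) :
    c ∈ LinearMap.ker (cocycleDualHomology k S n) ↔
      c.1 ∈ LinearMap.range (simplicialCoboundary k S n) := by
  rw [LinearMap.mem_ker, cocycleDualHomology, LinearMap.comp_apply, LinearEquiv.coe_coe,
    LinearEquiv.map_eq_zero_iff, LinearMap.comp_apply, ← LinearMap.mem_ker,
    mem_ker_dualHomologyMap, mem_range_dualMap_d_iff]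
  exact iff_of_eq (congrArg (· ∈ _) ((chainDualEquiv k S (n + 1)).apply_symm_apply c.1))

end CohomologyDual

section Hurewicz

/-- The affine map from a standard simplex to the unit interval with prescribed values at the
vertices. -/
def affineSimplex {n : ℕ} (v : Fin (n + 1) → unitInterval) :
    C(stdSimplex ℝ (Fin (n + 1)), unitInterval) where
  toFun z := ⟨∑ i, z i * (v i : ℝ), (convex_Icc 0 1).sum_mem (fun i _ => z.2.1 i) z.2.2
    fun i _ => (v i).2⟩
  continuous_toFun := Continuous.subtype_mk (continuous_finsetSum _ fun i _ =>
    ((continuous_apply i).comp continuous_subtype_val).mul continuous_const) _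

/-- The edge of a standard simplex from the vertex `i` to the vertex `j`. -/
def edgePath {n : ℕ} (i j : Fin (n + 1)) :
    Path (stdSimplex.vertex (S := ℝ) i) (stdSimplex.vertex j) where
  toFun t := stdSimplex.map ![i, j] (stdSimplexHomeomorphUnitInterval.symm t)
  continuous_toFun := (stdSimplex.continuous_map _).comp (Homeomorph.continuous _)
  source' := by
    rw [← stdSimplexHomeomorphUnitInterval_zero, Homeomorph.symm_apply_apply]
    exact stdSimplex.map_vertex _ _
  target' := by
    rw [← stdSimplexHomeomorphUnitInterval_one, Homeomorph.symm_apply_apply]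
    exact stdSimplex.map_vertex _ _

theorem edgePath_apply {n : ℕ} (i j l : Fin (n + 1)) (t : unitInterval) :
    edgePath i j t l = (if i = l then 1 - (t : ℝ) else 0) + (if j = l then (t : ℝ) else 0) := by
  change FunOnFinite.linearMap ℝ ℝ ![i, j] ![1 - (t : ℝ), t] l = _
  simp only [FunOnFinite.linearMap_apply_apply, Finset.sum_filter, Fin.sum_univ_two,
    Matrix.cons_val_zero, Matrix.cons_val_one]
  congr

theorem coe_affineSimplex_edgePath {n : ℕ} (v : Fin (n + 1) → unitInterval) (i j : Fin (n + 1))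
    (t : unitInterval) :
    (affineSimplex v (edgePath i j t) : ℝ) = (1 - t) * v i + t * v j := by
  change ∑ l, edgePath i j t l * (v l : ℝ) = _
  simp only [edgePath_apply, add_mul, ite_mul, zero_mul, Finset.sum_add_distrib,
    Finset.sum_ite_eq, Finset.mem_univ, if_true]

theorem edgePath_trans_homotopic {n : ℕ} (i j l : Fin (n + 1)) :
    ((edgePath i j).trans (edgePath j l)).Homotopic (edgePath i l) := by
  have : ContractibleSpace (stdSimplex ℝ (Fin (n + 1))) :=
    (convex_stdSimplex ℝ _).contractibleSpace ⟨_, (stdSimplex.vertex 0).2⟩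
  exact SimplyConnectedSpace.paths_homotopic _ _

variable {Y : Type u} [TopologicalSpace Y]

/-- The singular simplicial set of a space. -/
abbrev sing (Y : Type u) [TopologicalSpace Y] : SSet.{u} := TopCat.toSSet.obj (TopCat.of Y)

/-- Singular simplices are continuous maps from the standard simplex. -/
abbrev singEquiv {n : ℕ} : C(stdSimplex ℝ (Fin (n + 1)), Y) ≃ (sing Y) _⦋n⦌ :=
  (TopCat.toSSetObjEquiv (TopCat.of Y) (.op ⦋n⦌)).symm

/-- The singular `1`-simplex of a continuous map from the unit interval. -/
def pathSimplex (γ : C(unitInterval, Y)) : (sing Y) _⦋1⦌ :=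
  singEquiv (γ.comp (toContinuousMap stdSimplexHomeomorphUnitInterval))

theorem δ_singEquiv_eq {n : ℕ} (F : C(stdSimplex ℝ (Fin (n + 2)), Y)) (i : Fin (n + 2)) :
    (sing Y).δ i (singEquiv F) =
      singEquiv (F.comp ⟨stdSimplex.map i.succAbove, stdSimplex.continuous_map _⟩) := rfl

theorem δ_singEquiv (F : C(stdSimplex ℝ (Fin 3), Y)) {i j l : Fin 3}
    (h : (i.succAbove : Fin 2 → Fin 3) = ![j, l]) :
    (sing Y).δ i (singEquiv F) = pathSimplex (F.comp (edgePath j l).toContinuousMap) := by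
  rw [δ_singEquiv_eq]
  refine congrArg singEquiv (ContinuousMap.ext fun z => congrArg F ?_)
  change stdSimplex.map i.succAbove z = stdSimplex.map ![j, l]
    (stdSimplexHomeomorphUnitInterval.symm (stdSimplexHomeomorphUnitInterval z))
  rw [h, Homeomorph.symm_apply_apply]

theorem exists_path_pathSimplex_eq (σ : (sing Y) _⦋1⦌) :
    ∃ (a b : Y) (γ : Path a b), pathSimplex γ.toContinuousMap = σ := by
  refine ⟨_, _, (edgePath 0 1).map (singEquiv.symm σ).continuous,
    singEquiv.symm.injective (ContinuousMap.ext fun z => congrArg (singEquiv.symm σ) ?_)⟩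
  change stdSimplex.map ![0, 1]
    (stdSimplexHomeomorphUnitInterval.symm (stdSimplexHomeomorphUnitInterval z)) = z
  rw [Homeomorph.symm_apply_apply, show (![0, 1] : Fin 2 → Fin 2) = id by decide,
    stdSimplex.map_id_apply]

theorem δ_pathSimplex (γ : C(unitInterval, Y)) (i : Fin 2) :
    (sing Y).δ i (pathSimplex γ) = singEquiv (ContinuousMap.const _
      (γ (stdSimplexHomeomorphUnitInterval (stdSimplex.vertex (i.succAbove 0))))) := by
  refine (δ_singEquiv_eq (n := 0) (γ.comp (toContinuousMap stdSimplexHomeomorphUnitInterval))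
    i).trans (congrArg singEquiv (ContinuousMap.ext fun z => congrArg γ ?_))
  obtain rfl : z = stdSimplex.vertex 0 := Subsingleton.elim _ _
  exact congrArg stdSimplexHomeomorphUnitInterval (stdSimplex.map_vertex _ _)

theorem δ_zero_pathSimplex {a b : Y} (γ : Path a b) :
    (sing Y).δ 0 (pathSimplex γ.toContinuousMap) = singEquiv (ContinuousMap.const _ b) := by
  rw [δ_pathSimplex, show Fin.succAbove (0 : Fin 2) 0 = 1 by decide,
    stdSimplexHomeomorphUnitInterval_one]
  exact congrArg (fun z => singEquiv (ContinuousMap.const _ z)) γ.target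

theorem δ_one_pathSimplex {a b : Y} (γ : Path a b) :
    (sing Y).δ 1 (pathSimplex γ.toContinuousMap) = singEquiv (ContinuousMap.const _ a) := by
  rw [δ_pathSimplex, show Fin.succAbove (1 : Fin 2) 0 = 0 by decide,
    stdSimplexHomeomorphUnitInterval_zero]
  exact congrArg (fun z => singEquiv (ContinuousMap.const _ z)) γ.source

theorem trans_apply_of_eq_half {x y z : Y} (γ : Path x y) (δ : Path y z) {s t : unitInterval}
    (h : (s : ℝ) = 1 / 2 * t) : γ.trans δ s = γ t := by
  have ht := t.2.2
  rw [Path.trans_apply, dif_pos (by rw [h]; linarith)]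
  refine congrArg γ (Subtype.ext ?_)
  change 2 * (s : ℝ) = t
  linarith

theorem trans_apply_of_eq_half_add_half {x y z : Y} (γ : Path x y) (δ : Path y z)
    {s t : unitInterval} (h : (s : ℝ) = 1 / 2 * (1 - t) + t) : γ.trans δ s = δ t := by
  rw [← Path.symm_symm γ, ← Path.symm_symm δ, ← Path.trans_symm, Path.symm_apply,
    Path.symm_apply]
  refine trans_apply_of_eq_half _ _ ?_
  rw [unitInterval.coe_symm_eq, unitInterval.coe_symm_eq, h]
  ring

section Cocycle

variable {k : Type} [CommRing k]

theorem coboundary_zero_pathSimplex (b : (sing Y) _⦋0⦌ → k) {x y : Y} (γ : Path x y) :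
    simplicialCoboundary k (sing Y) 0 b (pathSimplex γ.toContinuousMap) =
      b (singEquiv (ContinuousMap.const _ y)) - b (singEquiv (ContinuousMap.const _ x)) := by
  rw [simplicialCoboundary_apply, Fin.sum_univ_two, δ_zero_pathSimplex, δ_one_pathSimplex]
  simp [sub_eq_add_neg]

theorem coboundary_one_singEquiv (c : (sing Y) _⦋1⦌ → k) (F : C(stdSimplex ℝ (Fin 3), Y)) :
    simplicialCoboundary k (sing Y) 1 c (singEquiv F) =
      c (pathSimplex (F.comp (edgePath 1 2).toContinuousMap)) -
        c (pathSimplex (F.comp (edgePath 0 2).toContinuousMap)) +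
        c (pathSimplex (F.comp (edgePath 0 1).toContinuousMap)) := by
  rw [simplicialCoboundary_apply, Fin.sum_univ_three,
    δ_singEquiv F (i := 0) (j := 1) (l := 2) (by decide),
    δ_singEquiv F (i := 1) (j := 0) (l := 2) (by decide),
    δ_singEquiv F (i := 2) (j := 0) (l := 1) (by decide)]
  simp [sub_eq_add_neg]

variable {c : (sing Y) _⦋1⦌ → k} (hc : c ∈ LinearMap.ker (simplicialCoboundary k (sing Y) 1))

include hc

theorem cocycle_triangle (F : C(stdSimplex ℝ (Fin 3), Y)) :
    c (pathSimplex (F.comp (edgePath 0 2).toContinuousMap)) =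
      c (pathSimplex (F.comp (edgePath 0 1).toContinuousMap)) +
        c (pathSimplex (F.comp (edgePath 1 2).toContinuousMap)) := by
  have h : simplicialCoboundary k (sing Y) 1 c (singEquiv F) = 0 := congrFun hc _
  rw [coboundary_one_singEquiv] at h
  linear_combination -h

theorem cocycle_const (a : Y) : c (pathSimplex (ContinuousMap.const _ a)) = 0 :=
  left_eq_add.1 (cocycle_triangle hc (ContinuousMap.const _ a))

theorem cocycle_trans {x y z : Y} (γ : Path x y) (δ : Path y z) :
    c (pathSimplex (γ.trans δ).toContinuousMap) =
      c (pathSimplex γ.toContinuousMap) + c (pathSimplex δ.toContinuousMap) := by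
  let half : unitInterval := ⟨1 / 2, by norm_num, by norm_num⟩
  let F := (γ.trans δ).toContinuousMap.comp (affineSimplex ![0, half, 1])
  have hu (i j : Fin 3) (t : unitInterval) := coe_affineSimplex_edgePath ![0, half, 1] i j t
  have h01 : F.comp (edgePath 0 1).toContinuousMap = γ.toContinuousMap :=
    ContinuousMap.ext fun t =>
      trans_apply_of_eq_half γ δ ((hu 0 1 t).trans (by simp [half, mul_comm]))
  have h12 : F.comp (edgePath 1 2).toContinuousMap = δ.toContinuousMap :=
    ContinuousMap.ext fun t =>
      trans_apply_of_eq_half_add_half γ δ ((hu 1 2 t).trans (by simp [half, mul_comm]))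
  have h02 : F.comp (edgePath 0 2).toContinuousMap = (γ.trans δ).toContinuousMap :=
    ContinuousMap.ext fun t =>
      congrArg (γ.trans δ) (Subtype.ext ((hu 0 2 t).trans (by simp)))
  rw [← h01, ← h12, ← h02]
  exact cocycle_triangle hc F

theorem cocycle_diagonal (H : C(unitInterval × unitInterval, Y)) :
    c (pathSimplex (H.comp ((ContinuousMap.id _).prodMk (ContinuousMap.id _)))) =
      c (pathSimplex (H.comp ((ContinuousMap.id _).prodMk (ContinuousMap.const _ 0)))) +
        c (pathSimplex (H.comp ((ContinuousMap.const _ 1).prodMk (ContinuousMap.id _)))) := by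
  have hu (i j : Fin 3) (t : unitInterval) := coe_affineSimplex_edgePath ![0, 1, 1] i j t
  have hv (i j : Fin 3) (t : unitInterval) := coe_affineSimplex_edgePath ![0, 0, 1] i j t
  convert cocycle_triangle hc
    (H.comp ((affineSimplex ![0, 1, 1]).prodMk (affineSimplex ![0, 0, 1]))) using 4
  all_goals
    refine ContinuousMap.ext fun t => congrArg H (Prod.ext (Subtype.ext ?_) (Subtype.ext ?_))
  · exact ((hu 0 2 t).trans (by simp)).symm
  · exact ((hv 0 2 t).trans (by simp)).symm
  · exact ((hu 0 1 t).trans (by simp)).symm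
  · exact ((hv 0 1 t).trans (by simp)).symm
  · exact ((hu 1 2 t).trans (by simp)).symm
  · exact ((hv 1 2 t).trans (by simp)).symm

theorem cocycle_homotopic {x y : Y} {γ δ : Path x y} (h : γ.Homotopic δ) :
    c (pathSimplex γ.toContinuousMap) = c (pathSimplex δ.toContinuousMap) := by
  obtain ⟨F⟩ := h
  -- The triangles below and above the diagonal of the square each have one constant side.
  have below := cocycle_diagonal hc F.toContinuousMap
  have above := cocycle_diagonal hc (F.toContinuousMap.comp .prodSwap)
  have bottom : F.toContinuousMap.comp ((ContinuousMap.id _).prodMk (ContinuousMap.const _ 0)) =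
      ContinuousMap.const _ x := ContinuousMap.ext fun s => F.source s
  have top : (F.toContinuousMap.comp .prodSwap).comp
      ((ContinuousMap.const _ 1).prodMk (ContinuousMap.id _)) =
      ContinuousMap.const _ y := ContinuousMap.ext fun s => F.target s
  have left : (F.toContinuousMap.comp .prodSwap).comp
      ((ContinuousMap.id _).prodMk (ContinuousMap.const _ 0)) = γ.toContinuousMap :=
    ContinuousMap.ext fun t => F.apply_zero t
  have right : F.toContinuousMap.comp ((ContinuousMap.const _ 1).prodMk (ContinuousMap.id _)) =
      δ.toContinuousMap := ContinuousMap.ext fun t => F.apply_one t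
  rw [bottom, right, cocycle_const hc, zero_add] at below
  rw [left, top, cocycle_const hc, add_zero] at above
  exact above.symm.trans below

theorem cocycle_symm {x y : Y} (γ : Path x y) :
    c (pathSimplex γ.symm.toContinuousMap) = -c (pathSimplex γ.toContinuousMap) := by
  have h := cocycle_homotopic hc (⟨(Path.Homotopy.reflTransSymm γ).symm⟩ :
    (γ.trans γ.symm).Homotopic (Path.refl x))
  rw [cocycle_trans hc] at h
  exact (neg_eq_of_add_eq_zero_right (h.trans (cocycle_const hc x))).symm

end Cocycle

section LoopEval

variable {k : Type} [CommRing k]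

/-- The homomorphism on the fundamental group given by the values of a `1`-cocycle on loops. -/
def cocycleHom (c : LinearMap.ker (simplicialCoboundary k (sing Y) 1)) (y : Y) :
    Additive (FundamentalGroup Y y) →+ k :=
  AddMonoidHom.mk' (fun g => Quotient.lift (fun γ : Path y y => c.1 (pathSimplex γ.toContinuousMap))
      (fun _ _ h => cocycle_homotopic c.2 h) (FundamentalGroup.toPath g.toMul)) <| by
    intro g h
    induction g using Path.Homotopic.Quotient.ind with | mk γ => ?_
    induction h using Path.Homotopic.Quotient.ind with | mk δ => ?_
    exact (cocycle_trans c.2 δ γ).trans (add_comm _ _)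

theorem cocycleHom_mk (c : LinearMap.ker (simplicialCoboundary k (sing Y) 1)) {y : Y}
    (γ : Path y y) : cocycleHom c y (.ofMul (FundamentalGroup.fromPath (.mk γ))) =
      c.1 (pathSimplex γ.toContinuousMap) := rfl

theorem fundamentalGroupHom_ext {M : Type*} [AddZeroClass M] {y : Y}
    {f g : Additive (FundamentalGroup Y y) →+ M}
    (h : ∀ γ : Path y y, f (.ofMul (FundamentalGroup.fromPath (.mk γ))) =
      g (.ofMul (FundamentalGroup.fromPath (.mk γ)))) : f = g :=
  AddMonoidHom.ext fun a => Path.Homotopic.Quotient.ind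
    (motive := fun q => f (.ofMul (FundamentalGroup.fromPath q)) =
      g (.ofMul (FundamentalGroup.fromPath q))) h (FundamentalGroup.toPath a.toMul)

/-- Evaluation of singular `1`-cocycles on the fundamental group. -/
def loopEval (k : Type) [CommRing k] (y : Y) :
    LinearMap.ker (simplicialCoboundary k (sing Y) 1) →ₗ[k]
      (Additive (FundamentalGroup Y y) →+ k) where
  toFun c := cocycleHom c y
  map_add' _ _ := fundamentalGroupHom_ext fun _ => rfl
  map_smul' _ _ := fundamentalGroupHom_ext fun _ => rfl

theorem mem_ker_loopEval [PathConnectedSpace Y] (y : Y)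
    (c : LinearMap.ker (simplicialCoboundary k (sing Y) 1)) :
    c ∈ LinearMap.ker (loopEval k y) ↔
      c.1 ∈ LinearMap.range (simplicialCoboundary k (sing Y) 0) := by
  constructor
  · intro h
    let p (a : Y) := PathConnectedSpace.somePath y a
    refine ⟨fun v => c.1 (pathSimplex (p (singEquiv.symm v (stdSimplex.vertex 0))).toContinuousMap),
      funext fun σ => ?_⟩
    obtain ⟨a, b, γ, rfl⟩ := exists_path_pathSimplex_eq σ
    have hloop : c.1 (pathSimplex (((p a).trans γ).trans (p b).symm).toContinuousMap) = 0 :=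
      (cocycleHom_mk c _).symm.trans (DFunLike.congr_fun (LinearMap.mem_ker.1 h) _)
    rw [cocycle_trans c.2, cocycle_trans c.2, cocycle_symm c.2] at hloop
    rw [coboundary_zero_pathSimplex, Equiv.symm_apply_apply, Equiv.symm_apply_apply,
      ContinuousMap.const_apply, ContinuousMap.const_apply]
    linear_combination -hloop
  · rintro ⟨b, hb⟩
    refine LinearMap.mem_ker.2 (fundamentalGroupHom_ext fun γ => ?_)
    refine (cocycleHom_mk c γ).trans ?_
    rw [← hb, coboundary_zero_pathSimplex, sub_self]
    rfl

/-- The class in the fundamental group of the loop obtained from a path by joining its end points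
to the base point. -/
def basedLoop [PathConnectedSpace Y] (y : Y) {a b : Y} (γ : Path a b) : FundamentalGroup Y y :=
  FundamentalGroup.fromPath
    (((Path.Homotopic.Quotient.mk (PathConnectedSpace.somePath y a)).trans (.mk γ)).trans
      (Path.Homotopic.Quotient.mk (PathConnectedSpace.somePath y b)).symm)

section BasedLoop

variable [PathConnectedSpace Y] (y : Y)

theorem basedLoop_congr {a b a' b' : Y} (γ : Path a b) (γ' : Path a' b') (h : ∀ t, γ t = γ' t) :
    basedLoop y γ = basedLoop y γ' := by
  obtain rfl : a = a' := by simpa using h 0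
  obtain rfl : b = b' := by simpa using h 1
  obtain rfl : γ = γ' := Path.ext (funext h)
  rfl

theorem basedLoop_homotopic {a b : Y} {γ δ : Path a b} (h : γ.Homotopic δ) :
    basedLoop y γ = basedLoop y δ := by
  rw [basedLoop, basedLoop, Path.Homotopic.Quotient.eq.2 h]

theorem basedLoop_trans {a b d : Y} (γ : Path a b) (δ : Path b d) :
    basedLoop y (γ.trans δ) = basedLoop y δ * basedLoop y γ := by
  let p (a : Y) : FundamentalGroupoid.mk y ⟶ FundamentalGroupoid.mk a :=
    Path.Homotopic.Quotient.mk (PathConnectedSpace.somePath y a)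
  let m {a b : Y} (γ : Path a b) : FundamentalGroupoid.mk a ⟶ FundamentalGroupoid.mk b :=
    Path.Homotopic.Quotient.mk γ
  change (p a ≫ (m γ ≫ m δ)) ≫ Groupoid.inv (p d) =
    ((p a ≫ m γ) ≫ Groupoid.inv (p b)) ≫ ((p b ≫ m δ) ≫ Groupoid.inv (p d))
  simp

theorem exists_basedLoop_eq_conj (γ : Path y y) : ∃ g : FundamentalGroup Y y,
    basedLoop y γ = g⁻¹ * FundamentalGroup.fromPath (.mk γ) * g :=
  ⟨FundamentalGroup.fromPath (.mk (PathConnectedSpace.somePath y y)), by rw [mul_assoc]; rfl⟩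

theorem map_ofMul_basedLoop (f : Additive (FundamentalGroup Y y) →+ k) (γ : Path y y) :
    f (.ofMul (basedLoop y γ)) = f (.ofMul (FundamentalGroup.fromPath (.mk γ))) := by
  obtain ⟨g, hg⟩ := exists_basedLoop_eq_conj y γ
  rw [hg, ofMul_mul, ofMul_mul, ofMul_inv, map_add, map_add, map_neg]
  ring

/-- The cochain whose values on paths are those of a homomorphism on the associated loops. -/
def loopCochain (f : Additive (FundamentalGroup Y y) →+ k) (σ : (sing Y) _⦋1⦌) : k :=
  f (.ofMul (basedLoop y ((edgePath 0 1).map (singEquiv.symm σ).continuous)))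

variable {y} in
theorem loopCochain_pathSimplex (f : Additive (FundamentalGroup Y y) →+ k) {a b : Y}
    (γ : Path a b) :
    loopCochain y f (pathSimplex γ.toContinuousMap) = f (.ofMul (basedLoop y γ)) := by
  refine congrArg (fun g => f (.ofMul g)) (basedLoop_congr y _ _ fun t => congrArg γ ?_)
  change stdSimplexHomeomorphUnitInterval
    (stdSimplex.map ![0, 1] (stdSimplexHomeomorphUnitInterval.symm t)) = t
  rw [show (![0, 1] : Fin 2 → Fin 2) = id by decide, stdSimplex.map_id_apply,
    Homeomorph.apply_symm_apply]

theorem loopCochain_mem_ker (f : Additive (FundamentalGroup Y y) →+ k) :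
    loopCochain y f ∈ LinearMap.ker (simplicialCoboundary k (sing Y) 1) := by
  refine LinearMap.mem_ker.2 (funext fun τ => ?_)
  obtain ⟨F, rfl⟩ := singEquiv.surjective τ
  have value (i j : Fin 3) : loopCochain y f (pathSimplex (F.comp (edgePath i j).toContinuousMap)) =
      f (.ofMul (basedLoop y ((edgePath i j).map F.continuous))) :=
    loopCochain_pathSimplex f ((edgePath i j).map F.continuous)
  have boundary : basedLoop y ((edgePath 0 2).map F.continuous) =
      basedLoop y ((edgePath 1 2).map F.continuous) *
        basedLoop y ((edgePath 0 1).map F.continuous) := by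
    rw [← basedLoop_trans, ← Path.map_trans]
    exact (basedLoop_homotopic y ((edgePath_trans_homotopic 0 1 2).map F)).symm
  rw [coboundary_one_singEquiv, value, value, value, boundary, ofMul_mul, map_add]
  exact (sub_add _ _ _).trans (by simp)

theorem loopEval_surjective : Function.Surjective (loopEval k y) := fun f =>
  ⟨⟨loopCochain y f, loopCochain_mem_ker y f⟩, fundamentalGroupHom_ext fun γ =>
    (loopCochain_pathSimplex f γ).trans (map_ofMul_basedLoop y f γ)⟩

end BasedLoop

/-- The Hurewicz theorem in degree one, over a field and in dual form. -/
def dualHomologyOneEquiv (k : Type) [Field k] [PathConnectedSpace Y] (y : Y) :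
    Module.Dual k (((sing Y).chainComplex (chainCoeff.{u} k)).homology 1) ≃ₗ[k]
      (Additive (FundamentalGroup Y y) →+ k) :=
  ((cocycleDualHomology k (sing Y) 0).quotKerEquivOfSurjective
      (cocycleDualHomology_surjective k (sing Y) 0)).symm ≪≫ₗ
    Submodule.quotEquivOfEq _ _ (Submodule.ext fun c =>
      (mem_ker_cocycleDualHomology c).trans (mem_ker_loopEval y c).symm) ≪≫ₗ
    (loopEval k y).quotKerEquivOfSurjective (loopEval_surjective y)

/-- The dual of `H₁(Y, ℂ)` is the space of homomorphisms from the fundamental group to `ℂ`. -/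
def dualH1Equiv [PathConnectedSpace Y] (y : Y) :
    Module.Dual ℂ (H1 Y) ≃ₗ[ℂ] (Additive (FundamentalGroup Y y) →+ ℂ) :=
  dualHomologyOneEquiv ℂ y

end LoopEval

end Hurewicz

end Homology

/-! ### Semilinear forms and Fitting ideals -/

section Minors

open Matrix

variable {k ι κ : Type*} [Field k] [Fintype κ]

theorem exists_linearIndependent_rows [Finite ι] {s : ℕ} (B : Matrix ι κ k) (hs : s ≤ B.rank) :
    ∃ a : Fin s → ι, LinearIndependent k (fun i => B (a i)) := by
  obtain ⟨η, a, ha, hspan, hli⟩ := exists_linearIndependent' k B.row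
  have : Finite η := Finite.of_injective a ha
  have : Fintype η := Fintype.ofFinite η
  have hcard : Fintype.card η = B.rank := by
    rw [rank_eq_finrank_span_row, ← hspan, finrank_span_eq_card hli]
  obtain ⟨e⟩ : Nonempty (Fin s ↪ η) := Function.Embedding.nonempty_of_card_le (by simpa [hcard])
  exact ⟨a ∘ e, hli.comp e e.injective⟩

theorem exists_minor_ne_zero [Finite ι] {s : ℕ} (B : Matrix ι κ k) (hs : s ≤ B.rank) :
    ∃ (a : Fin s → ι) (b : Fin s → κ), (B.submatrix a b).det ≠ 0 := by
  obtain ⟨a, ha⟩ := exists_linearIndependent_rows B hs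
  have hrank : s ≤ (B.submatrix a id)ᵀ.rank := by
    rw [rank_transpose, LinearIndependent.rank_matrix (M := B.submatrix a id) ha,
      Fintype.card_fin]
  obtain ⟨b, hb⟩ := exists_linearIndependent_rows _ hrank
  have hunit : IsUnit (B.submatrix a b)ᵀ := linearIndependent_rows_iff_isUnit.1 hb
  rw [isUnit_iff_isUnit_det, det_transpose] at hunit
  exact ⟨a, b, hunit.ne_zero⟩

theorem forall_minors_eq_zero_iff [Finite ι] (s : ℕ) (B : Matrix ι κ k) :
    (∀ (a : Fin s → ι) (b : Fin s → κ), (B.submatrix a b).det = 0) ↔ B.rank < s := by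
  refine ⟨fun h => ?_, fun h a b => ?_⟩
  · by_contra! hs
    obtain ⟨a, b, hab⟩ := exists_minor_ne_zero B hs
    exact hab (h a b)
  · by_contra hdet
    refine h.not_ge ?_
    rw [← Fintype.card_fin s, ← rank_of_det_ne_zero hdet]
    exact B.rank_submatrix_le a b

end Minors

section SemilinearForms

open Matrix

variable {R k M ι κ : Type*} [CommRing R] [CommRing k] (σ : R →+* k) [AddCommGroup M] [Module R M]

/-- The `σ`-semilinear form on the free module `R^ι` with given values on the standard basis. -/
def semilinearForm [Fintype ι] (v : ι → k) : (ι → R) →ₛₗ[σ] k where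
  toFun x := (σ ∘ x) ⬝ᵥ v
  map_add' x y := by
    rw [← add_dotProduct]
    exact congrArg (· ⬝ᵥ v) (funext fun i => map_add σ (x i) (y i))
  map_smul' a x := by
    rw [smul_eq_mul, ← smul_eq_mul, ← smul_dotProduct]
    exact congrArg (· ⬝ᵥ v) (funext fun i => map_mul σ a (x i))

theorem semilinearForm_mulVec [Fintype ι] [Fintype κ] (A : Matrix ι κ R) (v : ι → k) (w : κ → R) :
    semilinearForm σ v (A *ᵥ w) = (σ ∘ w) ⬝ᵥ ((A.map σ)ᵀ *ᵥ v) :=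
  calc (σ ∘ (A *ᵥ w)) ⬝ᵥ v
    _ = (A.map σ *ᵥ (σ ∘ w)) ⬝ᵥ v :=
      congrArg (· ⬝ᵥ v) (funext fun i => RingHom.map_mulVec σ A w i)
    _ = (σ ∘ w) ⬝ᵥ ((A.map σ)ᵀ *ᵥ v) := by
      rw [dotProduct_comm, dotProduct_mulVec, mulVec_transpose, dotProduct_comm]

variable [DecidableEq ι]

theorem comp_single_one (i : ι) : σ ∘ (Pi.single i 1 : ι → R) = Pi.single i 1 := by
  ext j
  rw [Function.comp_apply, Pi.apply_single (fun _ => σ) (fun _ => map_zero σ), map_one]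

theorem semilinearForm_single [Fintype ι] (v : ι → k) (i : ι) :
    semilinearForm σ v (Pi.single i 1) = v i := by
  change (σ ∘ (Pi.single i 1 : ι → R)) ⬝ᵥ v = v i
  rw [comp_single_one, single_one_dotProduct]

variable {σ} in
theorem semilinear_pi_ext [Finite ι] {f g : (ι → R) →ₛₗ[σ] k}
    (h : ∀ i, f (Pi.single i 1) = g (Pi.single i 1)) : f = g :=
  (Pi.basisFun R ι).ext fun i => by rw [Pi.basisFun_apply, h]

/-- The values of a semilinear form on the generators of a module. -/
def semilinearValues (π : (ι → R) →ₗ[R] M) : (M →ₛₗ[σ] k) →ₗ[k] (ι → k) where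
  toFun f i := f (π (Pi.single i 1))
  map_add' _ _ := rfl
  map_smul' _ _ := rfl

theorem semilinearValues_injective [Finite ι] {π : (ι → R) →ₗ[R] M} (hπ : Function.Surjective π) :
    Function.Injective (semilinearValues σ π) := fun f g h =>
  LinearMap.ext <| hπ.forall.2 <| LinearMap.congr_fun <|
    semilinear_pi_ext (f := f.comp π) (g := g.comp π) (congrFun h)

variable [Fintype ι]

theorem comp_eq_semilinearForm (π : (ι → R) →ₗ[R] M) (f : M →ₛₗ[σ] k) :
    f.comp π = semilinearForm σ (semilinearValues σ π f) :=
  semilinear_pi_ext fun i => (semilinearForm_single σ (semilinearValues σ π f) i).symm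

variable {π : (ι → R) →ₗ[R] M} (hπ : Function.Surjective π)
include hπ

theorem exists_semilinearValues_eq {v : ι → k}
    (hv : LinearMap.ker π ≤ LinearMap.ker (semilinearForm σ v)) :
    ∃ f : M →ₛₗ[σ] k, semilinearValues σ π f = v := by
  refine ⟨((LinearMap.ker π).liftQ (semilinearForm σ v) hv).comp
    (π.quotKerEquivOfSurjective hπ).symm.toLinearMap, funext fun i => ?_⟩
  refine (congrArg ((LinearMap.ker π).liftQ (semilinearForm σ v) hv)
    (LinearMap.quotKerEquivOfSurjective_symm_apply π hπ _)).trans ?_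
  rw [Submodule.liftQ_apply, semilinearForm_single]

theorem range_semilinearValues [Fintype κ] {A : Matrix ι κ R}
    (hA : LinearMap.range A.mulVecLin = LinearMap.ker π) :
    LinearMap.range (semilinearValues σ π) = LinearMap.ker (A.map σ)ᵀ.mulVecLin := by
  classical
  ext v
  rw [LinearMap.mem_ker, mulVecLin_apply]
  constructor
  · rintro ⟨f, rfl⟩
    ext j
    have hπA : π (A *ᵥ Pi.single j 1) = 0 := LinearMap.mem_ker.1 (hA ▸ ⟨_, rfl⟩)
    have hf := semilinearForm_mulVec σ A (semilinearValues σ π f) (Pi.single j 1)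
    rw [← comp_eq_semilinearForm, LinearMap.comp_apply, hπA, map_zero, comp_single_one,
      single_one_dotProduct] at hf
    exact hf.symm
  · intro hv
    refine exists_semilinearValues_eq σ hπ ?_
    rw [← hA]
    rintro _ ⟨w, rfl⟩
    rw [LinearMap.mem_ker, mulVecLin_apply, semilinearForm_mulVec, hv, dotProduct_zero]

end SemilinearForms

section Finite

variable {R k : Type*} [CommRing R] [CommRing k] [IsNoetherianRing k] (σ : R →+* k)
  (M : Type*) [AddCommGroup M] [Module R M] [Module.Finite R M]

theorem finite_semilinear : Module.Finite k (M →ₛₗ[σ] k) := by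
  obtain ⟨_, _, hπ⟩ := Module.Finite.exists_fin' R M
  exact Module.Finite.of_injective _ (semilinearValues_injective σ hπ)

end Finite

section Fitting

variable {R k : Type*} [CommRing R] [Field k] (σ : R →+* k)

theorem finrank_semilinear_add_rank {M ι κ : Type*} [AddCommGroup M] [Module R M] [Fintype ι]
    [Fintype κ] {A : Matrix ι κ R} {π : (ι → R) →ₗ[R] M} (hπ : Function.Surjective π)
    (hA : LinearMap.range A.mulVecLin = LinearMap.ker π) :
    Module.finrank k (M →ₛₗ[σ] k) + (A.map σ).rank = Fintype.card ι := by
  classical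
  rw [← LinearMap.finrank_range_of_inj (semilinearValues_injective σ hπ),
    range_semilinearValues σ hπ hA, ← Matrix.rank_transpose, Matrix.rank, add_comm,
    LinearMap.finrank_range_add_finrank_ker, Module.finrank_fintype_fun_eq_card]

variable (M : Type*) [AddCommGroup M] [Module R M]

variable (R) in
theorem exists_presentation_matrix [Module.FinitePresentation R M] :
    ∃ (m n : ℕ) (A : Matrix (Fin n) (Fin m) R) (π : (Fin n → R) →ₗ[R] M),
      Function.Surjective π ∧ LinearMap.range A.mulVecLin = LinearMap.ker π := by
  obtain ⟨n, m, π, g, hπ, hg⟩ := Module.FinitePresentation.exists_fin' R M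
  exact ⟨m, n, LinearMap.toMatrix' g, π, hπ, by
    rw [← Matrix.toLin'_apply', Matrix.toLin'_toMatrix', hg.linearMap_ker_eq]⟩

theorem fittingIdeal_le_ker_iff [Module.FinitePresentation R M] (j : ℕ) :
    fittingIdeal R M j ≤ RingHom.ker σ ↔ j ≤ Module.finrank k (M →ₛₗ[σ] k) := by
  have map_minor {m n s : ℕ} (A : Matrix (Fin n) (Fin m) R) (a : Fin s → Fin n)
      (b : Fin s → Fin m) : σ (A.submatrix a b).det = ((A.map σ).submatrix a b).det :=
    RingHom.map_det σ _
  rw [fittingIdeal, Ideal.span_le]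
  constructor
  · intro h
    obtain ⟨m, n, A, π, hπ, hA⟩ := exists_presentation_matrix R M
    have hsum := finrank_semilinear_add_rank σ hπ hA
    have hrank := (forall_minors_eq_zero_iff (n + 1 - j) (A.map σ)).1 fun a b => by
      rw [← map_minor]
      exact h ⟨m, n, A, π, hπ, hA, a, b, rfl⟩
    rw [Fintype.card_fin] at hsum
    omega
  · rintro h _ ⟨m, n, A, π, hπ, hA, a, b, rfl⟩
    have hsum := finrank_semilinear_add_rank σ hπ hA
    rw [Fintype.card_fin] at hsum
    rw [SetLike.mem_coe, RingHom.mem_ker, map_minor]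
    exact (forall_minors_eq_zero_iff (n + 1 - j) (A.map σ)).2 (by omega) a b

end Fitting

section Depth

theorem isNoetherianRing_laurentRing (r : ℕ) : IsNoetherianRing (LaurentRing r) :=
  Algebra.FiniteType.isNoetherianRing ℂ _

theorem depth_eq_finrank {G : Type*} [Group G] {r : ℕ} (φ : G →* FreeAb r)
    (hφ : Function.Surjective φ)
    [Module.Finite (LaurentRing r) (AlexanderModule φ hφ)] (P : Fin r → ℂˣ) :
    depth φ hφ P =
      Module.finrank ℂ (AlexanderModule φ hφ →ₛₗ[(evalTorus P : LaurentRing r →+* ℂ)] ℂ) := by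
  have := isNoetherianRing_laurentRing r
  have := Module.finitePresentation_of_finite (LaurentRing r) (AlexanderModule φ hφ)
  have hdepth : {j : ℕ | P ∈ charVariety φ hφ j} = Set.Iic (Module.finrank ℂ
      (AlexanderModule φ hφ →ₛₗ[(evalTorus P : LaurentRing r →+* ℂ)] ℂ)) :=
    Set.ext (fittingIdeal_le_ker_iff (evalTorus P : LaurentRing r →+* ℂ) (AlexanderModule φ hφ))
  rw [depth, hdepth, csSup_Iic]

end Depth

/-! ### Equivariant homomorphisms on normal subgroups -/

section CommonEigenspace

variable {k V W ι κ : Type*} [CommRing k] [AddCommGroup V] [Module k V] [AddCommGroup W]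
  [Module k W] {T : ι → Module.End k V}

/-- The vectors on which every operator of the family `T` acts as the corresponding scalar. -/
def commonEigenspace (T : ι → Module.End k V) (c : ι → k) : Submodule k V :=
  ⨅ i, (T i).eigenspace (c i)

theorem mem_commonEigenspace {c : ι → k} {v : V} :
    v ∈ commonEigenspace T c ↔ ∀ i, T i v = c i • v := by
  simp only [commonEigenspace, Submodule.mem_iInf, Module.End.mem_eigenspace_iff]

theorem commonEigenspace_comp {f : κ → ι} (hf : Function.Surjective f) (c : ι → k) :
    commonEigenspace (T ∘ f) (c ∘ f) = commonEigenspace T c :=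
  hf.iInf_comp fun i => (T i).eigenspace (c i)

/-- An isomorphism intertwining two families of operators identifies their eigenspaces. -/
def commonEigenspaceEquiv {S : ι → Module.End k W} (e : V ≃ₗ[k] W)
    (he : ∀ i v, e (T i v) = S i (e v)) (c : ι → k) :
    commonEigenspace T c ≃ₗ[k] commonEigenspace S c :=
  e.ofSubmodules _ _ <| by
    ext w
    obtain ⟨v, rfl⟩ := e.surjective w
    simp only [Submodule.mem_map_equiv, e.symm_apply_apply, mem_commonEigenspace, ← he, ← map_smul,
      e.injective.eq_iff]

end CommonEigenspace

section WeightDecomposition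

variable {B V : Type*} [AddCommGroup B] [AddCommGroup V] [Module ℂ V]
  (ρ : Representation ℂ (Multiplicative B) V)

/-- The subspace of `V` on which the abelian group `B` acts through the character `ψ`. -/
def weightSpace (ψ : AddChar B ℂ) : Submodule ℂ V :=
  commonEigenspace (fun b => ρ (Multiplicative.ofAdd b)) ψ

variable [Fintype B]

/-- The projection of `V` onto the weight space of `ψ`. -/
def weightProj (ψ : AddChar B ℂ) : Module.End ℂ V :=
  (Fintype.card B : ℂ)⁻¹ • ∑ b, ψ (-b) • ρ (Multiplicative.ofAdd b)

theorem weightProj_apply (ψ : AddChar B ℂ) (v : V) : weightProj ρ ψ v =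
    (Fintype.card B : ℂ)⁻¹ • ∑ b, ψ (-b) • ρ (Multiplicative.ofAdd b) v := by
  simp only [weightProj, LinearMap.smul_apply, LinearMap.sum_apply]

theorem weightProj_mem (ψ : AddChar B ℂ) (v : V) : weightProj ρ ψ v ∈ weightSpace ρ ψ := by
  refine mem_commonEigenspace.2 fun a => ?_
  rw [weightProj_apply, map_smul, map_sum, smul_comm (ψ a),
    ← Equiv.sum_comp (Equiv.addLeft a) fun b => ψ (-b) • ρ (Multiplicative.ofAdd b) v,
    Finset.smul_sum (r := ψ a)]
  congr 1
  refine Finset.sum_congr rfl fun b _ => ?_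
  rw [map_smul, Equiv.coe_addLeft, ofAdd_add, map_mul, Module.End.mul_apply, smul_smul,
    ← AddChar.map_add_eq_mul, neg_add, add_neg_cancel_left]

theorem weightProj_eq_ite [DecidableEq (AddChar B ℂ)] {θ ψ : AddChar B ℂ} {v : V}
    (hv : v ∈ weightSpace ρ θ) : weightProj ρ ψ v = if θ = ψ then v else 0 := by
  have horth : ∑ b, ψ (-b) * θ b = if θ = ψ then (Fintype.card B : ℂ) else 0 := by
    simpa only [sub_eq_zero, AddChar.sub_apply, mul_comm] using AddChar.sum_eq_ite (θ - ψ)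
  have hcard : (Fintype.card B : ℂ) ≠ 0 := Nat.cast_ne_zero.2 Fintype.card_ne_zero
  simp only [weightProj_apply, mem_commonEigenspace.1 hv, smul_smul, ← Finset.sum_smul, horth]
  split_ifs
  · rw [inv_mul_cancel₀ hcard, one_smul]
  · rw [mul_zero, zero_smul]

theorem sum_weightProj (v : V) : ∑ ψ, weightProj ρ ψ v = v := by
  classical
  have hcard : (Fintype.card B : ℂ) ≠ 0 := Nat.cast_ne_zero.2 Fintype.card_ne_zero
  simp only [weightProj_apply, ← Finset.smul_sum]
  rw [Finset.sum_comm]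
  simp only [← Finset.sum_smul, AddChar.sum_apply_eq_ite, neg_eq_zero, ite_smul, zero_smul,
    Finset.sum_ite_eq', Finset.mem_univ, if_true, ofAdd_zero, map_one, Module.End.one_apply,
    inv_smul_smul₀ hcard]

/-- A representation of a finite abelian group is the product of its weight spaces. -/
def weightDecomposition : V ≃ₗ[ℂ] ∀ ψ : AddChar B ℂ, weightSpace ρ ψ :=
  LinearEquiv.ofLinearMap
    (LinearMap.pi fun ψ => (weightProj ρ ψ).codRestrict _ (weightProj_mem ρ ψ))
    (∑ ψ, (weightSpace ρ ψ).subtype ∘ₗ LinearMap.proj ψ)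
    (by
      classical
      refine LinearMap.ext fun w => funext fun ψ => Subtype.ext ?_
      simp [map_sum, weightProj_eq_ite ρ (w _).2])
    (LinearMap.ext fun v => by simp [sum_weightProj])

end WeightDecomposition

section EquivariantHoms

/-- Composition with a group homomorphism, as a linear map between spaces of homomorphisms to the
additive group of `k`. -/
def homPullback (k : Type*) [CommRing k] {G H : Type*} [Group G] [Group H] (f : G →* H) :
    (Additive H →+ k) →ₗ[k] (Additive G →+ k) where
  toFun u := u.comp f.toAdditive
  map_add' _ _ := rfl
  map_smul' _ _ := rfl

/-- Isomorphic groups have isomorphic spaces of homomorphisms to the additive group of `k`. -/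
def homPullbackEquiv (k : Type*) [CommRing k] {G H : Type*} [Group G] [Group H] (e : G ≃* H) :
    (Additive H →+ k) ≃ₗ[k] (Additive G →+ k) :=
  LinearEquiv.ofLinearMap (homPullback k e.toMonoidHom) (homPullback k e.symm.toMonoidHom)
    (LinearMap.ext fun u => AddMonoidHom.ext fun x => congrArg u (e.symm_apply_apply x))
    (LinearMap.ext fun u => AddMonoidHom.ext fun x => congrArg u (e.apply_symm_apply x))

variable {k G : Type*} [CommRing k] [Group G]

section

variable (k) (N : Subgroup G) [N.Normal]

/-- The operator on homomorphisms `N → k` given by conjugation by `g`. -/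
def conjPullback (g : G) : Module.End k (Additive N →+ k) :=
  homPullback k (MulAut.conjNormal g).toMonoidHom

/-- The homomorphisms `N → k` on which conjugation by `G` acts through the character `χ`. -/
def equivariantHoms (χ : G →* k) : Submodule k (Additive N →+ k) :=
  commonEigenspace (conjPullback k N) χ

end

variable {N : Subgroup G} [N.Normal]

theorem conjPullback_mul (g h : G) :
    conjPullback k N (g * h) = conjPullback k N h * conjPullback k N g := by
  ext u x
  exact congrArg (fun y : N => u (.ofMul y)) (by rw [map_mul]; rfl)

theorem conjPullback_of_mem {g : G} (hg : g ∈ N) : conjPullback k N g = 1 := by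
  refine LinearMap.ext fun u => AddMonoidHom.ext fun x => ?_
  have hconj : MulAut.conjNormal g x.toMul = ⟨g, hg⟩ * x.toMul * (⟨g, hg⟩ : N)⁻¹ := rfl
  change u (.ofMul (MulAut.conjNormal g x.toMul)) = u x
  rw [hconj, ofMul_mul, ofMul_mul, ofMul_inv, map_add, map_add, map_neg, add_right_comm,
    add_neg_cancel, zero_add, ofMul_toMul]

theorem mem_equivariantHoms {χ : G →* k} {u : Additive N →+ k} : u ∈ equivariantHoms k N χ ↔
    ∀ g x, u (.ofMul (MulAut.conjNormal g x)) = χ g * u (.ofMul x) :=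
  mem_commonEigenspace.trans (forall_congr' fun _ => DFunLike.ext_iff)

section QuotientAction

variable {B : Type*} [AddCommGroup B] {π : G →* Multiplicative B}

theorem conjPullback_ker_congr {g h : G} (hgh : π g = π h) :
    conjPullback k π.ker g = conjPullback k π.ker h := by
  have hmem : h⁻¹ * g ∈ π.ker := by rw [MonoidHom.mem_ker, map_mul, map_inv, hgh, inv_mul_cancel]
  rw [← mul_inv_cancel_left h g, conjPullback_mul, conjPullback_of_mem hmem, one_mul]

/-- The action of `B = G / ker π` on the homomorphisms `ker π → k`: the class of `g` acts as
conjugation by `g`. -/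
def quotientConjRep (hπ : Function.Surjective π) :
    Representation k (Multiplicative B) (Additive π.ker →+ k) where
  toFun b := conjPullback k π.ker (Function.surjInv hπ b)
  map_one' := by
    rw [← conjPullback_of_mem (one_mem π.ker)]
    exact conjPullback_ker_congr ((Function.surjInv_eq hπ 1).trans (map_one π).symm)
  map_mul' a b := by
    rw [← conjPullback_mul]
    exact conjPullback_ker_congr (by simp only [Function.surjInv_eq, map_mul, mul_comm])

theorem quotientConjRep_apply (hπ : Function.Surjective π) (g : G) :
    quotientConjRep (k := k) hπ (π g) = conjPullback k π.ker g :=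
  conjPullback_ker_congr (Function.surjInv_eq hπ _)

variable (π) in
/-- The character of `G` induced by a character of the quotient `B`. -/
def quotientChar (ψ : AddChar B k) : G →* k :=
  ψ.toMonoidHom.comp π

theorem weightSpace_quotientConjRep (hπ : Function.Surjective π) (ψ : AddChar B ℂ) :
    weightSpace (quotientConjRep hπ) ψ = equivariantHoms ℂ π.ker (quotientChar π ψ) := by
  have hsurj : Function.Surjective fun g => (π g).toAdd := hπ
  refine (commonEigenspace_comp hsurj _).symm.trans ?_
  exact congrArg (commonEigenspace · _) (funext (quotientConjRep_apply hπ))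

end QuotientAction

end EquivariantHoms

section RestrictionAlongNormal

open scoped commutatorElement

section CommRing

variable {k G : Type*} [CommRing k] [Group G] {K N : Subgroup G} [K.Normal] [N.Normal] {χ : G →* k}

/-- Restriction of equivariant homomorphisms to a smaller normal subgroup. -/
def equivariantRestrict (h : K ≤ N) (χ : G →* k) :
    equivariantHoms k N χ →ₗ[k] equivariantHoms k K χ :=
  (homPullback k (Subgroup.inclusion h)).restrict fun _ hu =>
    mem_equivariantHoms.2 fun g x => mem_equivariantHoms.1 hu g (Subgroup.inclusion h x)

theorem map_conjNormal_mul_inv {u : Additive N →+ k} (hu : u ∈ equivariantHoms k N χ) (g : G)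
    (x : N) : u (.ofMul (MulAut.conjNormal g x * x⁻¹)) = (χ g - 1) * u (.ofMul x) := by
  rw [ofMul_mul, ofMul_inv, map_add, map_neg, mem_equivariantHoms.1 hu]
  ring

variable (hK : commutator G ≤ K)

/-- The value `u ⁅g, x⁆` of a homomorphism defined on a subgroup containing all commutators. As a
function of `x` it is a crossed homomorphism when `u` is equivariant. -/
def commutatorValue (u : Additive K →+ k) (g x : G) : k :=
  u (.ofMul ⟨⁅g, x⁆, hK (Subgroup.commutator_mem_commutator (Subgroup.mem_top g)
    (Subgroup.mem_top x))⟩)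

theorem commutatorValue_coe {u : Additive K →+ k} (hu : u ∈ equivariantHoms k K χ) (g : G)
    (x : K) : commutatorValue hK u g x = (χ g - 1) * u (.ofMul x) :=
  map_conjNormal_mul_inv hu g x

theorem commutatorValue_mul {u : Additive K →+ k} (hu : u ∈ equivariantHoms k K χ) (g x y : G) :
    commutatorValue hK u g (x * y) = commutatorValue hK u g x + χ x * commutatorValue hK u g y := by
  rw [commutatorValue, commutatorValue, commutatorValue, ← mem_equivariantHoms.1 hu, ← map_add,
    ← ofMul_mul]
  congr 2
  ext
  simp only [Subgroup.coe_mul, MulAut.conjNormal_apply, commutatorElement_def]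
  group

theorem commutatorValue_conj {u : Additive K →+ k} (hu : u ∈ equivariantHoms k K χ) (g h : G)
    {x : G} (hx : χ x = 1) :
    commutatorValue hK u g (h * x * h⁻¹) = χ h * commutatorValue hK u g x := by
  have hconj : χ (h * x * h⁻¹) = 1 := by
    rw [map_mul, map_mul, hx, mul_one, ← map_mul, mul_inv_cancel, map_one]
  have hmul := commutatorValue_mul hK hu g (h * x * h⁻¹) h
  rw [inv_mul_cancel_right, commutatorValue_mul hK hu, hconj] at hmul
  linear_combination -hmul

end CommRing

variable {k G : Type*} [Field k] [Group G] {K N : Subgroup G} [K.Normal] [N.Normal] {χ : G →* k}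
  (hK : commutator G ≤ K) {g : G}

include hK in
theorem equivariantRestrict_injective (h : K ≤ N) (hg : χ g ≠ 1) :
    Function.Injective (equivariantRestrict h χ) := by
  refine (injective_iff_map_eq_zero _).2 fun u hu => Subtype.ext (AddMonoidHom.ext fun x => ?_)
  have hmem : ⁅g, (x.toMul : G)⁆ ∈ K :=
    hK (Subgroup.commutator_mem_commutator (Subgroup.mem_top _) (Subgroup.mem_top _))
  have hzero : (χ g - 1) * u.1 x = 0 :=
    (map_conjNormal_mul_inv u.2 g x.toMul).symm.trans
      (DFunLike.congr_fun (congrArg Subtype.val hu) (.ofMul ⟨_, hmem⟩))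
  exact (mul_eq_zero.1 hzero).resolve_left (sub_ne_zero.2 hg)

include hK in
theorem equivariantRestrict_surjective (h : K ≤ N) (hg : χ g ≠ 1) (hN : N ≤ χ.ker) :
    Function.Surjective (equivariantRestrict h χ) := by
  rintro ⟨u, hu⟩
  have hne : χ g - 1 ≠ 0 := sub_ne_zero.2 hg
  let v : Additive N →+ k := AddMonoidHom.mk'
    (fun x => (χ g - 1)⁻¹ * commutatorValue hK u g x.toMul) fun x y => by
      rw [toMul_add, Subgroup.coe_mul, commutatorValue_mul hK hu, hN x.toMul.2, one_mul, mul_add]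
  have hv : v ∈ equivariantHoms k N χ := mem_equivariantHoms.2 fun h x => by
    change (χ g - 1)⁻¹ * commutatorValue hK u g (h * x * h⁻¹) = χ h * (_ * _)
    rw [commutatorValue_conj hK hu g h (hN x.2), mul_left_comm]
    rfl
  refine ⟨⟨v, hv⟩, Subtype.ext (AddMonoidHom.ext fun x => ?_)⟩
  change (χ g - 1)⁻¹ * commutatorValue hK u g (x.toMul : K) = u x
  rw [commutatorValue_coe hK hu, inv_mul_cancel_left₀ hne, ofMul_toMul]

/-- For a character `χ` that is nontrivial on `G` and trivial on `N`, restriction from `N` to a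
smaller normal subgroup containing all commutators is an isomorphism. -/
def equivariantRestrictEquiv (h : K ≤ N) (hg : χ g ≠ 1) (hN : N ≤ χ.ker) :
    equivariantHoms k N χ ≃ₗ[k] equivariantHoms k K χ :=
  LinearEquiv.ofBijective (equivariantRestrict h χ)
    ⟨equivariantRestrict_injective hK h hg, equivariantRestrict_surjective hK h hg hN⟩

end RestrictionAlongNormal

section InvariantHoms

section CommRing

variable {k G : Type*} [CommRing k] [Group G] (N : Subgroup G) [N.Normal]

theorem mem_equivariantHoms_one {N : Subgroup G} [N.Normal] {u : Additive N →+ k} :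
    u ∈ equivariantHoms k N 1 ↔
      ∀ g x, u (.ofMul (MulAut.conjNormal g x)) = u (.ofMul x) := by
  simp only [mem_equivariantHoms, MonoidHom.one_apply, one_mul]

theorem homPullback_subtype_mem (u : Additive G →+ k) :
    homPullback k N.subtype u ∈ equivariantHoms k N 1 :=
  mem_equivariantHoms_one.2 fun g x => by
    change u (.ofMul (g * x * g⁻¹)) = u (.ofMul x)
    rw [ofMul_mul, ofMul_mul, ofMul_inv, map_add, map_add, map_neg]
    ring

/-- Restriction of homomorphisms `G → k` to a normal subgroup. -/
def invariantRestrict : (Additive G →+ k) →ₗ[k] equivariantHoms k N 1 :=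
  (homPullback k N.subtype).codRestrict _ (homPullback_subtype_mem N)

end CommRing

variable {k G : Type*} [Field k] [Group G] {N : Subgroup G} [N.Normal]

theorem invariantRestrict_injective (hN : (N.index : k) ≠ 0) :
    Function.Injective (invariantRestrict (k := k) N) := by
  refine (injective_iff_map_eq_zero _).2 fun u hu => AddMonoidHom.ext fun x => ?_
  have hpow : u (.ofMul (x.toMul ^ N.index)) = 0 :=
    DFunLike.congr_fun (congrArg Subtype.val hu) (.ofMul ⟨_, N.pow_index_mem x.toMul⟩)
  rw [ofMul_pow, ofMul_toMul, map_nsmul, nsmul_eq_mul] at hpow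
  exact (mul_eq_zero.1 hpow).resolve_left hN

theorem transfer_coe_of_forall_conj [N.FiniteIndex] {A : Type*} [CommGroup A] (f : N →* A)
    (hf : ∀ g x, f (MulAut.conjNormal g x) = f x) (x : N) :
    MonoidHom.transfer f (x : G) = f x ^ N.index := by
  have hsmul (q : G ⧸ N) : (x : G)⁻¹ • q = q := by
    induction q using QuotientGroup.induction_on with
    | H g =>
      refine QuotientGroup.eq.2 ?_
      have hconj := Subgroup.Normal.conj_mem ‹N.Normal› x x.2 g⁻¹
      simpa only [smul_eq_mul, mul_inv_rev, inv_inv, mul_assoc] using hconj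
  let _ := N.fintypeQuotientOfFiniteIndex
  rw [MonoidHom.transfer_def f default, Subgroup.leftTransversals.diff]
  refine (Finset.prod_congr rfl fun q _ => ?_).trans (Finset.prod_const (f x)) |>.trans ?_
  · rw [← hf ((default : N.LeftTransversal).2.leftQuotientEquiv q : G)⁻¹ x]
    congr 1
    ext
    simp only [Subgroup.smul_apply_eq_smul_apply_inv_smul, hsmul, smul_eq_mul,
      MulAut.conjNormal_apply, inv_inv, mul_assoc]
  · rw [Finset.card_univ, ← Nat.card_eq_fintype_card]
    rfl

theorem invariantRestrict_surjective (hN : (N.index : k) ≠ 0) :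
    Function.Surjective (invariantRestrict (k := k) N) := by
  rintro ⟨u, hu⟩
  have : N.FiniteIndex := ⟨fun h => hN (by rw [h, Nat.cast_zero])⟩
  let f : N →* Multiplicative k := AddMonoidHom.toMultiplicativeRight u
  refine ⟨(N.index : k)⁻¹ • MonoidHom.toAdditiveLeft (MonoidHom.transfer f),
    Subtype.ext (AddMonoidHom.ext fun x => ?_)⟩
  have htransfer := transfer_coe_of_forall_conj f
    (fun g x => congrArg Multiplicative.ofAdd (mem_equivariantHoms_one.1 hu g x)) x.toMul
  change (N.index : k)⁻¹ * (MonoidHom.transfer f (x.toMul : G)).toAdd = u x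
  rw [htransfer, toAdd_pow, nsmul_eq_mul]
  exact inv_mul_cancel_left₀ hN _

/-- Homomorphisms `G → k` are the conjugation invariant homomorphisms on a normal subgroup whose
index is invertible in `k`; the inverse of restriction is the normalized transfer. -/
def invariantRestrictEquiv (hN : (N.index : k) ≠ 0) :
    (Additive G →+ k) ≃ₗ[k] equivariantHoms k N 1 :=
  LinearEquiv.ofBijective (invariantRestrict N)
    ⟨invariantRestrict_injective hN, invariantRestrict_surjective hN⟩

end InvariantHoms

section Finiteness

variable (k : Type*) [CommRing k] [IsNoetherianRing k]

theorem finite_addMonoidHom (A : Type*) [AddCommGroup A] [AddGroup.FG A] :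
    Module.Finite k (A →+ k) := by
  obtain ⟨s, hs⟩ := ‹AddGroup.FG A›.out
  let eval : (A →+ k) →ₗ[k] (s → k) :=
    { toFun := fun u a => u a, map_add' := fun _ _ => rfl, map_smul' := fun _ _ => rfl }
  refine Module.Finite.of_injective eval fun u v huv => ?_
  exact AddMonoidHom.eq_of_eqOn_dense hs fun a ha => congrFun huv ⟨a, ha⟩

variable {k} {G Q : Type*} [Group G] [CommGroup Q]

theorem finite_hom_of_finite_equivariantHoms_ker {φ : G →* Q} (hφ : Function.Surjective φ)
    [Group.FG Q] [Module.Finite k (equivariantHoms k φ.ker 1)] :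
    Module.Finite k (Additive G →+ k) := by
  have : Module.Finite k (Additive Q →+ k) := finite_addMonoidHom k _
  have hexact : LinearMap.range (homPullback k φ) = LinearMap.ker (invariantRestrict φ.ker) := by
    ext u
    refine ⟨?_, fun hu => ?_⟩
    · rintro ⟨v, rfl⟩
      refine Subtype.ext (AddMonoidHom.ext fun x => ?_)
      change v (.ofMul (φ (x.toMul : φ.ker))) = 0
      rw [MonoidHom.mem_ker.1 x.toMul.2, ofMul_one, map_zero]
    · have hu' : homPullback k φ.ker.subtype u = 0 := congrArg Subtype.val (LinearMap.mem_ker.1 hu)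
      have hker : φ.toAdditive.ker ≤ u.ker := fun x hx =>
        AddMonoidHom.mem_ker.2 (DFunLike.congr_fun hu' (.ofMul (⟨x.toMul, hx⟩ : φ.ker)))
      exact ⟨AddMonoidHom.liftOfSurjective φ.toAdditive hφ ⟨u, hker⟩,
        AddMonoidHom.liftOfRightInverse_comp φ.toAdditive _ _ ⟨u, hker⟩⟩
  have : IsNoetherian k (equivariantHoms k φ.ker 1) :=
    isNoetherian_of_isNoetherianRing_of_finite (R := k) (M := equivariantHoms k φ.ker 1)
  have := isNoetherian_of_range_eq_ker (P := equivariantHoms k φ.ker 1) _ _ hexact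
  infer_instance

end Finiteness

/-! ### The Alexander module -/

section RepresentationForms

variable {k H V : Type*} [CommRing k] [Monoid H] [AddCommGroup V] [Module k V]
  {ρ : Representation k H V} {χ : H →* k}

theorem apply_asAlgebraHom_of_mem {l : Module.Dual k V}
    (hl : l ∈ commonEigenspace (fun h => (ρ h).dualMap) χ) (F : MonoidAlgebra k H) (v : V) :
    l (ρ.asAlgebraHom F v) = MonoidAlgebra.lift k k H χ F * l v := by
  induction F using MonoidAlgebra.induction_on with
  | of h =>
    rw [Representation.asAlgebraHom_of, MonoidAlgebra.lift_of]
    exact LinearMap.congr_fun (mem_commonEigenspace.1 hl h) v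
  | add F F' hF hF' => rw [map_add, map_add, LinearMap.add_apply, map_add, hF, hF', add_mul]
  | smul t F hF => rw [map_smul, map_smul, LinearMap.smul_apply, map_smul, hF, smul_mul_assoc]

variable (ρ χ) in
/-- The forms on a module over the monoid algebra that are semilinear along evaluation at a
character `χ` are the linear forms on which the monoid acts through `χ`. -/
def asModuleSemilinearEquiv :
    (ρ.asModule →ₛₗ[(MonoidAlgebra.lift k k H χ : MonoidAlgebra k H →+* k)] k) ≃ₗ[k]
      commonEigenspace (fun h => (ρ h).dualMap) χ where
  toFun l := ⟨
    { toFun := fun v => l (ρ.asModuleEquiv.symm v)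
      map_add' := fun v w => by rw [map_add, map_add]
      map_smul' := fun t v => by
        rw [Representation.asModuleEquiv_symm_map_smul, LinearMap.map_smulₛₗ]
        exact congrArg (· • _) ((MonoidAlgebra.lift k k H χ).commutes t) },
    mem_commonEigenspace.2 fun h => LinearMap.ext fun v => by
      change l (ρ.asModuleEquiv.symm (ρ h v)) = χ h * l (ρ.asModuleEquiv.symm v)
      rw [Representation.asModuleEquiv_symm_map_rho, LinearMap.map_smulₛₗ, smul_eq_mul]
      exact congrArg (· * _) (MonoidAlgebra.lift_of χ h)⟩
  invFun l :=
    { toFun := fun m => l.1 (ρ.asModuleEquiv m)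
      map_add' := fun x y => by rw [map_add, map_add]
      map_smul' := fun F m => by
        rw [Representation.asModuleEquiv_map_smul]
        exact apply_asAlgebraHom_of_mem l.2 F _ }
  map_add' _ _ := rfl
  map_smul' _ _ := rfl
  left_inv _ := rfl
  right_inv _ := rfl

end RepresentationForms

section Alexander

open scoped TensorProduct

section DualAbelianization

variable (k G : Type*) [CommRing k] [Group G]

theorem homPullback_abelianization_of_bijective :
    Function.Bijective (homPullback k (Abelianization.of (G := G))) := by
  refine ⟨fun u v huv => ?_, fun u => ⟨MonoidHom.toAdditiveLeft (Abelianization.lift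
    (AddMonoidHom.toMultiplicativeRight u)), ?_⟩⟩
  · refine AddMonoidHom.ext fun x => ?_
    obtain ⟨g, hg⟩ := QuotientGroup.mk_surjective x.toMul
    exact (congrArg (fun y => u (.ofMul y)) hg).symm.trans
      ((DFunLike.congr_fun huv (.ofMul g)).trans (congrArg (fun y => v (.ofMul y)) hg))
  · exact AddMonoidHom.ext fun _ => rfl

/-- The linear forms on `Gᵃᵇ ⊗ k` are the homomorphisms `G → k`. -/
def dualAbelianizationEquiv :
    Module.Dual k (k ⊗[ℤ] Additive (Abelianization G)) ≃ₗ[k] (Additive G →+ k) :=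
  (LinearMap.liftBaseChangeEquiv k).symm ≪≫ₗ (addMonoidHomLequivInt k).symm ≪≫ₗ
    LinearEquiv.ofBijective _ (homPullback_abelianization_of_bijective k G)

end DualAbelianization

variable {G : Type*} [Group G] {r : ℕ} (φ : G →* FreeAb r)

theorem dualAbelianizationEquiv_dualMap_conjRep (g : G) (l : Module.Dual ℂ (AlexanderSpace φ)) :
    dualAbelianizationEquiv ℂ φ.ker ((conjRep φ g).dualMap l) =
      conjPullback ℂ φ.ker g (dualAbelianizationEquiv ℂ φ.ker l) := by
  refine AddMonoidHom.ext fun x => ?_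
  change l (conjRep φ g (1 ⊗ₜ .ofMul (Abelianization.of x.toMul))) =
    l (1 ⊗ₜ .ofMul (Abelianization.of (MulAut.conjNormal g x.toMul)))
  simp [conjRep]

variable {φ} (hφ : Function.Surjective φ)

theorem alexanderRep_apply (g : G) : alexanderRep φ hφ (φ g) = conjRep φ g := by
  have hsymm : (QuotientGroup.quotientKerEquivOfSurjective φ hφ).symm (φ g) = (g : G ⧸ φ.ker) :=
    (MulEquiv.symm_apply_eq _).2 rfl
  exact congrArg (QuotientGroup.lift φ.ker (conjRep φ) fun g hg => conjRep_ker φ g hg) hsymm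

theorem commonEigenspace_alexanderRep (χ : FreeAb r →* ℂ) :
    commonEigenspace (fun t => (alexanderRep φ hφ t).dualMap) χ =
      commonEigenspace (fun g => (conjRep φ g).dualMap) (χ.comp φ) := by
  refine (commonEigenspace_comp hφ _).symm.trans (congrArg (commonEigenspace · _) ?_)
  exact funext fun g => congrArg LinearMap.dualMap (alexanderRep_apply hφ g)

/-- The forms on the fibre of the Alexander module at `P` are the homomorphisms `ker φ → ℂ` on
which conjugation acts through the character of `ℤ^r` given by `P`. -/
def alexanderFormsEquiv (P : Fin r → ℂˣ) :
    (AlexanderModule φ hφ →ₛₗ[(evalTorus P : LaurentRing r →+* ℂ)] ℂ) ≃ₗ[ℂ]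
      equivariantHoms ℂ φ.ker ((torusChar P).comp φ) :=
  asModuleSemilinearEquiv (alexanderRep φ hφ) (torusChar P) ≪≫ₗ
    LinearEquiv.ofEq _ _ (commonEigenspace_alexanderRep hφ (torusChar P)) ≪≫ₗ
    commonEigenspaceEquiv (dualAbelianizationEquiv ℂ φ.ker)
      (dualAbelianizationEquiv_dualMap_conjRep φ) ((torusChar P).comp φ)

theorem torusChar_one : torusChar (1 : Fin r → ℂˣ) = 1 := by
  ext t
  simp [torusChar]

variable [hfin : Module.Finite (LaurentRing r) (AlexanderModule φ hφ)]
include hfin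

theorem finrank_equivariantHoms_ker (P : Fin r → ℂˣ) :
    Module.finrank ℂ (equivariantHoms ℂ φ.ker ((torusChar P).comp φ)) = depth φ hφ P := by
  rw [depth_eq_finrank, (alexanderFormsEquiv hφ P).finrank_eq]

include hφ

theorem finite_equivariantHoms_ker (P : Fin r → ℂˣ) :
    Module.Finite ℂ (equivariantHoms ℂ φ.ker ((torusChar P).comp φ)) :=
  have := finite_semilinear (evalTorus P : LaurentRing r →+* ℂ) (AlexanderModule φ hφ)
  Module.Finite.equiv (alexanderFormsEquiv hφ P)

theorem finite_hom_of_finite_alexanderModule : Module.Finite ℂ (Additive G →+ ℂ) := by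
  have hker := finite_equivariantHoms_ker hφ 1
  rw [torusChar_one, MonoidHom.one_comp] at hker
  exact finite_hom_of_finite_equivariantHoms_ker hφ

end Alexander

/-! ### Abelian covers -/

section Reduction

variable {r : ℕ} (n : Fin r → ℕ)

theorem reductionMod_surjective : Function.Surjective (reductionMod n) := by
  intro b
  choose t ht using fun i => ZMod.intCast_surjective (b.toAdd i)
  exact ⟨.ofAdd t, Multiplicative.toAdd.injective (funext ht)⟩

theorem reductionMod_single (i : Fin r) :
    reductionMod n (.ofAdd (Pi.single i 1)) = .ofAdd (Pi.single i 1) := by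
  refine Multiplicative.toAdd.injective (funext fun j => ?_)
  obtain rfl | hij := eq_or_ne j i
  · simp [reductionMod]
  · simp [reductionMod, hij]

theorem torusChar_single (P : Fin r → ℂˣ) (i : Fin r) :
    torusChar P (.ofAdd (Pi.single i 1)) = P i := by
  change ((∏ j, P j ^ (Pi.single i 1 : Fin r → ℤ) j : ℂˣ) : ℂ) = P i
  rw [Finset.prod_eq_single i (fun j _ hj => by simp [hj]) (by simp)]
  simp

theorem freeAb_hom_ext {M : Type*} [CommMonoid M] {f g : FreeAb r →* M}
    (h : ∀ i, f (.ofAdd (Pi.single i 1)) = g (.ofAdd (Pi.single i 1))) : f = g :=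
  MonoidHom.toAdditiveRight.injective <|
    AddMonoidHom.functions_ext' _ _ _ fun i => AddMonoidHom.ext_int (h i)

/-- The point of the torus corresponding to a character of `⊕ ℤ/n_i`: its coordinates are the
values at the standard generators. -/
def charPoint (ψ : AddChar (∀ i, ZMod (n i)) ℂ) (i : Fin r) : ℂˣ :=
  ψ.toMonoidHom.toHomUnits (.ofAdd (Pi.single i 1))

theorem torusChar_charPoint (ψ : AddChar (∀ i, ZMod (n i)) ℂ) :
    torusChar (charPoint n ψ) = ψ.toMonoidHom.comp (reductionMod n) :=
  freeAb_hom_ext fun i => by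
    rw [torusChar_single, MonoidHom.comp_apply, reductionMod_single]
    rfl

theorem charPoint_injective : Function.Injective (charPoint n) := by
  intro ψ θ h
  refine AddChar.toMonoidHomEquiv.injective
    ((MonoidHom.cancel_right (reductionMod_surjective n)).1 ?_)
  exact (torusChar_charPoint n ψ).symm.trans
    ((congrArg torusChar h).trans (torusChar_charPoint n θ))

theorem charPoint_zero : charPoint n 0 = 1 := by
  ext i
  simp [charPoint]

theorem charPoint_pow (ψ : AddChar (∀ i, ZMod (n i)) ℂ) (i : Fin r) :
    charPoint n ψ i ^ n i = 1 := by
  rw [charPoint, ← map_pow, ← ofAdd_nsmul, ← Pi.single_smul]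
  simp

theorem exists_charPoint_eq [∀ i, NeZero (n i)] {ω : Fin r → ℂˣ} (hω : ∀ i, ω i ^ n i = 1) :
    ∃ ψ, charPoint n ψ = ω := by
  have hω' (i : Fin r) : (ω i : ℂ) ^ n i = 1 := by
    rw [← Units.val_pow_eq_pow_val, hω, Units.val_one]
  let ψ : AddChar (∀ i, ZMod (n i)) ℂ :=
    ∏ i, (AddChar.zmodChar (n i) (hω' i)).compAddMonoidHom (Pi.evalAddMonoidHom _ i)
  refine ⟨ψ, funext fun i => Units.ext ?_⟩
  calc ψ (Pi.single i 1)
      = ∏ j, AddChar.zmodChar (n j) (hω' j) (Pi.single (M := fun i => ZMod (n i)) i 1 j) :=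
        AddChar.prod_apply _ _ _
    _ = AddChar.zmodChar (n i) (hω' i) 1 := by
        rw [Finset.prod_eq_single i (fun j _ hj => by simp [hj]) (by simp), Pi.single_eq_same]
    _ = ω i := by simpa using AddChar.zmodChar_apply' (hω' i) 1

theorem charPoint_image [∀ i, NeZero (n i)] :
    charPoint n '' {ψ | ψ ≠ 0} = {ω : Fin r → ℂˣ | (∀ i, ω i ^ n i = 1) ∧ ω ≠ 1} := by
  ext ω
  constructor
  · rintro ⟨ψ, hψ, rfl⟩
    exact ⟨charPoint_pow n ψ, fun h => hψ (charPoint_injective n (h.trans (charPoint_zero n).symm))⟩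
  · rintro ⟨hω, hne⟩
    obtain ⟨ψ, rfl⟩ := exists_charPoint_eq n hω
    exact ⟨ψ, fun h => hne (h ▸ charPoint_zero n), rfl⟩

end Reduction

section FiniteAbelianQuotient

variable {G B : Type*} [Group G] [AddCommGroup B] [Finite B] {π : G →* Multiplicative B}
  (hπ : Function.Surjective π)

/-- For a finite abelian quotient `B` of `G`, the homomorphisms from the kernel to `ℂ` decompose
under the conjugation action according to the characters of `B`. -/
def homKerDecomposition :
    (Additive π.ker →+ ℂ) ≃ₗ[ℂ] ∀ ψ : AddChar B ℂ, equivariantHoms ℂ π.ker (quotientChar π ψ) :=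
  have := Fintype.ofFinite B
  weightDecomposition (quotientConjRep hπ) ≪≫ₗ
    LinearEquiv.piCongrRight fun ψ => LinearEquiv.ofEq _ _ (weightSpace_quotientConjRep hπ ψ)

variable (π) in
/-- The part of `homKerDecomposition` at the trivial character consists of the restrictions of
homomorphisms defined on the whole group. -/
def invariantHomKerEquiv :
    (Additive G →+ ℂ) ≃ₗ[ℂ] equivariantHoms ℂ π.ker (quotientChar π (0 : AddChar B ℂ)) :=
  have : π.ker.FiniteIndex := Subgroup.finiteIndex_ker π
  invariantRestrictEquiv (Nat.cast_ne_zero.2 Subgroup.FiniteIndex.index_ne_zero)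

variable [Module.Finite ℂ (Additive G →+ ℂ)]
  (hfin : ∀ ψ : AddChar B ℂ, ψ ≠ 0 →
    Module.Finite ℂ (equivariantHoms ℂ π.ker (quotientChar π ψ)))
include hfin

theorem finite_equivariantHoms_quotientChar (ψ : AddChar B ℂ) :
    Module.Finite ℂ (equivariantHoms ℂ π.ker (quotientChar π ψ)) := by
  obtain rfl | hψ := eq_or_ne ψ 0
  · exact Module.Finite.equiv (invariantHomKerEquiv π)
  · exact hfin ψ hψ

include hπ

theorem finite_hom_ker : Module.Finite ℂ (Additive π.ker →+ ℂ) :=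
  have := finite_equivariantHoms_quotientChar hfin
  Module.Finite.equiv (homKerDecomposition hπ).symm

theorem finrank_hom_ker :
    Module.finrank ℂ (Additive π.ker →+ ℂ) = Module.finrank ℂ (Additive G →+ ℂ) +
      ∑ᶠ ψ ∈ {ψ : AddChar B ℂ | ψ ≠ 0},
        Module.finrank ℂ (equivariantHoms ℂ π.ker (quotientChar π ψ)) := by
  classical
  have := Fintype.ofFinite B
  have := finite_equivariantHoms_quotientChar hfin
  have hset : {ψ : AddChar B ℂ | ψ ≠ 0} = (Finset.univ.erase 0 : Finset (AddChar B ℂ)) := by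
    ext ψ
    simp
  rw [(homKerDecomposition hπ).finrank_eq, Module.finrank_pi_fintype, hset, finsum_mem_coe_finset,
    ← Finset.add_sum_erase _ _ (Finset.mem_univ (0 : AddChar B ℂ)),
    (invariantHomKerEquiv π).finrank_eq]

end FiniteAbelianQuotient

section AbelianCovers

variable {G : Type*} [Group G] {r : ℕ} {φ : G →* FreeAb r} (n : Fin r → ℕ)

theorem quotientChar_reductionMod_comp (ψ : AddChar (∀ i, ZMod (n i)) ℂ) :
    quotientChar ((reductionMod n).comp φ) ψ = (torusChar (charPoint n ψ)).comp φ := by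
  rw [torusChar_charPoint]
  rfl

variable (hφ : Function.Surjective φ)
include hφ

theorem nonempty_equivariantHoms_reductionMod_equiv {ψ : AddChar (∀ i, ZMod (n i)) ℂ}
    (hψ : ψ ≠ 0) :
    Nonempty (equivariantHoms ℂ ((reductionMod n).comp φ).ker
        (quotientChar ((reductionMod n).comp φ) ψ) ≃ₗ[ℂ]
      equivariantHoms ℂ φ.ker ((torusChar (charPoint n ψ)).comp φ)) := by
  obtain ⟨b, hb⟩ := AddChar.ne_zero_iff.1 hψ
  obtain ⟨g, hg⟩ := ((reductionMod_surjective n).comp hφ) (.ofAdd b)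
  have hcomm : commutator G ≤ φ.ker := Abelianization.commutator_subset_ker φ
  have hker : φ.ker ≤ ((reductionMod n).comp φ).ker := φ.ker_le_comap (reductionMod n).ker
  have hχg : quotientChar ((reductionMod n).comp φ) ψ g ≠ 1 := fun h =>
    hb ((congrArg (fun c => ψ (Multiplicative.toAdd c)) hg).symm.trans h)
  have hχker : ((reductionMod n).comp φ).ker ≤
      (quotientChar ((reductionMod n).comp φ) ψ).ker :=
    ((reductionMod n).comp φ).ker_le_comap ψ.toMonoidHom.ker
  rw [← quotientChar_reductionMod_comp]
  exact ⟨equivariantRestrictEquiv hcomm hker hχg hχker⟩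

variable [hfin : Module.Finite (LaurentRing r) (AlexanderModule φ hφ)]
include hfin

theorem finite_equivariantHoms_reductionMod {ψ : AddChar (∀ i, ZMod (n i)) ℂ} (hψ : ψ ≠ 0) :
    Module.Finite ℂ (equivariantHoms ℂ ((reductionMod n).comp φ).ker
      (quotientChar ((reductionMod n).comp φ) ψ)) := by
  obtain ⟨e⟩ := nonempty_equivariantHoms_reductionMod_equiv n hφ hψ
  have := finite_equivariantHoms_ker hφ (charPoint n ψ)
  exact Module.Finite.equiv e.symm

theorem finrank_equivariantHoms_reductionMod {ψ : AddChar (∀ i, ZMod (n i)) ℂ} (hψ : ψ ≠ 0) :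
    Module.finrank ℂ (equivariantHoms ℂ ((reductionMod n).comp φ).ker
      (quotientChar ((reductionMod n).comp φ) ψ)) = depth φ hφ (charPoint n ψ) := by
  obtain ⟨e⟩ := nonempty_equivariantHoms_reductionMod_equiv n hφ hψ
  rw [e.finrank_eq, finrank_equivariantHoms_ker hφ]

variable [∀ i, NeZero (n i)]

theorem finite_hom_ker_reductionMod :
    Module.Finite ℂ (Additive ((reductionMod n).comp φ).ker →+ ℂ) :=
  have := finite_hom_of_finite_alexanderModule hφ
  finite_hom_ker (π := (reductionMod n).comp φ) ((reductionMod_surjective n).comp hφ)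
    fun _ => finite_equivariantHoms_reductionMod n hφ

theorem finrank_hom_ker_reductionMod :
    Module.finrank ℂ (Additive ((reductionMod n).comp φ).ker →+ ℂ) =
      Module.finrank ℂ (Additive G →+ ℂ) +
        ∑ᶠ ω ∈ {ω : Fin r → ℂˣ | (∀ i, ω i ^ n i = 1) ∧ ω ≠ 1}, depth φ hφ ω := by
  have := finite_hom_of_finite_alexanderModule hφ
  rw [finrank_hom_ker (π := (reductionMod n).comp φ) ((reductionMod_surjective n).comp hφ)
      fun _ => finite_equivariantHoms_reductionMod n hφ,
    ← charPoint_image, finsum_mem_image (charPoint_injective n).injOn]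
  exact congrArg _ (finsum_mem_congr rfl fun _ => finrank_equivariantHoms_reductionMod n hφ)

end AbelianCovers

section Coverings

theorem mapOfEq_injective_of_isCoveringMap {X E : Type*} [TopologicalSpace X] [TopologicalSpace E]
    {p : C(E, X)} (hp : IsCoveringMap p) {e : E} {x : X} (hx : p e = x) :
    Function.Injective (FundamentalGroup.mapOfEq p hx) := by
  subst hx
  intro a b hab
  rw [FundamentalGroup.mapOfEq_apply, FundamentalGroup.mapOfEq_apply,
    Path.Homotopic.Quotient.cast_rfl_rfl, Path.Homotopic.Quotient.cast_rfl_rfl] at hab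
  exact hp.injective_path_homotopic_map e e hab

/-- The fundamental group of the covering corresponding to the subgroup `N` is `N`. -/
def IsCoveringOf.fundamentalGroupEquiv {X E : Type*} [TopologicalSpace X] [TopologicalSpace E]
    {p : C(E, X)} {e : E} {x : X} {hx : p e = x} {N : Subgroup (FundamentalGroup X x)}
    (hp : IsCoveringOf p e hx N) : FundamentalGroup E e ≃* N :=
  (MonoidHom.ofInjective (mapOfEq_injective_of_isCoveringMap hp.isCoveringMap hx)).trans
    (MulEquiv.subgroupCongr hp.range_eq)

variable {Y : Type*} [TopologicalSpace Y] [PathConnectedSpace Y] (y : Y)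

theorem finite_H1 [Module.Finite ℂ (Additive (FundamentalGroup Y y) →+ ℂ)] :
    Module.Finite ℂ (H1 Y) :=
  (Module.finite_dual_iff ℂ).1 (Module.Finite.equiv (dualH1Equiv y).symm)

theorem finrank_H1 :
    Module.finrank ℂ (H1 Y) = Module.finrank ℂ (Additive (FundamentalGroup Y y) →+ ℂ) := by
  rw [← (dualH1Equiv y).finrank_eq, Subspace.dual_finrank_eq]

end Coverings

end

theorem mainTheorem4_general {X : Type*} [TopologicalSpace X] [PathConnectedSpace X] (x : X)
    {r : ℕ} (φ : FundamentalGroup X x →* FreeAb r) (hφ : Function.Surjective φ)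
    (hfin : Module.Finite (LaurentRing r) (AlexanderModule φ hφ))
    (n : Fin r → ℕ) (hn : ∀ i, 0 < n i)
    {E : Type*} [TopologicalSpace E] (p : C(E, X)) (e : E) (hx : p e = x)
    (hE : IsCoveringOf p e hx ((reductionMod n).comp φ).ker) :
    Module.Finite ℂ (H1 X) ∧ Module.Finite ℂ (H1 E) ∧
    Module.finrank ℂ (H1 E) = Module.finrank ℂ (H1 X) +
      ∑ᶠ ω ∈ {ω : Fin r → ℂˣ | (∀ i, ω i ^ n i = 1) ∧ ω ≠ 1}, depth φ hφ ω ∧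
    (Module.finrank ℂ (H1 X) = r →
      Module.finrank ℂ (H1 E) = r +
        ∑ᶠ ω ∈ {ω : Fin r → ℂˣ | (∀ i, ω i ^ n i = 1) ∧ ω ≠ 1}, depth φ hφ ω) := by
  have := hE.pathConnected
  have (i : Fin r) : NeZero (n i) := ⟨(hn i).ne'⟩
  have hX := finite_hom_of_finite_alexanderModule hφ
  have hN := finite_hom_ker_reductionMod n hφ
  let restrict := homPullbackEquiv ℂ hE.fundamentalGroupEquiv
  have := Module.Finite.equiv restrict
  have hrank : Module.finrank ℂ (H1 E) = Module.finrank ℂ (H1 X) +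
      ∑ᶠ ω ∈ {ω : Fin r → ℂˣ | (∀ i, ω i ^ n i = 1) ∧ ω ≠ 1}, depth φ hφ ω := by
    rw [finrank_H1 e, ← restrict.finrank_eq, finrank_hom_ker_reductionMod n hφ, finrank_H1 x]
  exact ⟨finite_H1 x, finite_H1 e, hrank, fun h => hrank.trans (by rw [h])⟩

theorem mainTheorem4 {X : Type*} [TopologicalSpace X] [T2Space X]
    [Topology.CWComplex (Set.univ : Set X)] [PathConnectedSpace X] (x : X)
    {r : ℕ} (φ : FundamentalGroup X x →* FreeAb r) (hφ : Function.Surjective φ)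
    (hfin : Module.Finite (LaurentRing r) (AlexanderModule φ hφ))
    (n : Fin r → ℕ) (hn : ∀ i, 0 < n i)
    {E : Type*} [TopologicalSpace E] (p : C(E, X)) (e : E) (hx : p e = x)
    (hE : IsCoveringOf p e hx ((reductionMod n).comp φ).ker) :
    Module.Finite ℂ (H1 X) ∧ Module.Finite ℂ (H1 E) ∧
    Module.finrank ℂ (H1 E) = Module.finrank ℂ (H1 X) +
      ∑ᶠ ω ∈ {ω : Fin r → ℂˣ | (∀ i, ω i ^ n i = 1) ∧ ω ≠ 1}, depth φ hφ ω ∧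
    (Module.finrank ℂ (H1 X) = r →
      Module.finrank ℂ (H1 E) = r +
        ∑ᶠ ω ∈ {ω : Fin r → ℂˣ | (∀ i, ω i ^ n i = 1) ∧ ω ≠ 1}, depth φ hφ ω) :=
  mainTheorem4_general x φ hφ hfin n hn p e hx hE
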